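/- Let $d\ge 1$, $q=\frac{2(d+2)}{d}$, $\epsilon>0$ and $0<\sigma,\tilde\sigma<1$. There are constants $c=c(d,\epsilon,\sigma,\tilde\sigma)>0$ and $\eta_0=\eta_0(d,\epsilon,\sigma,\tilde\sigma)>0$ and, for each $\alpha\ge\frac12$, a constant $c_1=c_1(d,\alpha,\epsilon,\sigma,\tilde\sigma)>0$ such that the following holds. Let $0<T^*<\infty$ and let $u\in C([0,T^*);L^2(\mathbb R^d))\cap L^q_{loc}([0,T^*);L^q(\mathbb R^d))$ be a maximal solution of $iu_t+\Delta u=\pm|u|^{4/d}u$, $u(0)=u_0$, blowing up at $T^*$, i.e. $\|u\|_{L^q([0,t]\times\mathbb R^d)}<\infty$ for all $t<T^*$ and $\|u\|_{L^q([0,T^*)\times\mathbb R^d)}=\infty$. Put $F(t)=\|u\|_{L^q([0,t]\times\mathbb R^d)}^q$, let $\kappa(\epsilon)=2^{-(d+2)}(\epsilon\|u_0\|_{L^2}^{-2}/8)^{1/d}$, $L(t)=\frac12\kappa(\epsilon)(T^*-t)^{-\alpha}$, and let $P_{L(t)}$ be the Fourier restriction to $\{|\xi|\le L(t)\}$ (Fourier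 transform with kernel $e^{-2\pi i x\cdot\xi}$). Let $\eta>0$ and let $0=t_0<t_1<\dots$ with $t_n\to T^*$ be such that $\|u\|_{L^q((t_n,t_{n+1})\times\mathbb R^d)}=\eta$ for all $n$. Let $I_n\subset[t_n,t_{n+1})$ be intervals with $|I_n|=\sigma(t_{n+1}-t_n)$, and suppose that $$\liminf_{n\to\infty}\ \inf_{t\in I_n}\ \sup_{\substack{\text{cubes }J\subset\mathbb R^d\\ l(J)<(T^*-t)^\alpha}}\int_J|P_{L(t)}u(t,x)|^2\,dx\ \ge\ (1-\tilde\sigma)\,\epsilon .$$ Then: 1. For all sufficiently large $n$ and a.e. $t\in I_n$, $F$ is differentiable at $t$ and $F'(t)\ge c\,(T^*-t)^{-2\alpha}$. 2. If $\alpha>\frac12$, there is a real constant $C$, independent of $t$, with $F(t)\ge c_1(T^*-t)^{-(2\alpha-1)}+C$ for all $t\in\bigcup_n I_n$. 3. If $\alpha=\frac12$, and if $\eta\le\eta_0$ or $T^*-t_{n+1}\ge\frac12(T^*-t_n)$ for all sufficiently large $n$, there is a real constant $C$, independent of $t$, with $F(t)\ge c_1|\ln(T^*-t)|+C$ for all $t\in\bigcup_n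 I_n$. -/

import Mathlib

open MeasureTheory Set Filter Topology
open scoped ENNReal FourierTransform

noncomputable section

namespace CriticalNLS

/-- The physical space `ℝ^d` with its Euclidean structure. -/
abbrev Space (d : ℕ) : Type := EuclideanSpace ℝ (Fin d)

/-- The space `L²(ℝ^d; ℂ)`. -/
abbrev L2 (d : ℕ) : Type := Lp (α := Space d) ℂ 2

/-- The diagonal Strichartz exponent `q = 2 (d + 2) / d`. -/
def strichartzExponent (d : ℕ) : ℝ := 2 * ((d : ℝ) + 2) / d

/-- `∫_A ∫_{ℝ^d} |u(s, x)|^q dx ds` with `q = 2 (d + 2) / d`, for a set `A` of times. -/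
def strichartzPow {d : ℕ} (u : ℝ → L2 d) (A : Set ℝ) : ℝ≥0∞ :=
  ∫⁻ s in A, ∫⁻ x, ‖u s x‖ₑ ^ strichartzExponent d

/-- The norm of `u` in `L^q(A × ℝ^d)`, `q = 2 (d + 2) / d`. -/
def strichartzNorm {d : ℕ} (u : ℝ → L2 d) (A : Set ℝ) : ℝ≥0∞ :=
  strichartzPow u A ^ (1 / strichartzExponent d)

/-- `F(t) = ‖u‖^q` in `L^q([0, t] × ℝ^d)`, `q = 2 (d + 2) / d`, as a real number (it is finite
for all times before the blow-up time of a maximal solution). -/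
def F {d : ℕ} (u : ℝ → L2 d) (t : ℝ) : ℝ := (strichartzPow u (Icc 0 t)).toReal

/-- `u` solves `i u_t + Δ u = μ |u|^{4/d} u` on `[0, T)` with initial datum `u 0`, in the class
`C([0, T); L²) ∩ L^q_loc([0, T); L^q)`, `q = 2 (d + 2) / d`. The equation is integrated in time and
tested against compactly supported smooth functions of the space variable. -/
structure IsSolution {d : ℕ} (μ : ℝ) (u : ℝ → L2 d) (T : ℝ) : Prop where
  continuousOn : ContinuousOn u (Ico 0 T)
  strichartz_lt_top : ∀ t ∈ Ico 0 T, strichartzNorm u (Icc 0 t) < ⊤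
  equation : ∀ φ : Space d → ℂ, ContDiff ℝ (⊤ : ℕ∞) φ → HasCompactSupport φ → ∀ t ∈ Ico 0 T,
    (∫ x, u t x * φ x) = (∫ x, u 0 x * φ x)
      + Complex.I * (∫ s in (0 : ℝ)..t, ∫ x, u s x * Laplacian.laplacian φ x)
      - Complex.I * μ *
        (∫ s in (0 : ℝ)..t, ∫ x, ((‖u s x‖ ^ (4 / (d : ℝ)) : ℝ) : ℂ) * u s x * φ x)

/-- `u` is a maximal forward solution with finite blow-up time `T`: the diagonal Strichartz norm
is finite on `[0, t]` for all `t < T`, and infinite on `[0, T)`. -/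
structure IsMaximalSolution {d : ℕ} (μ : ℝ) (u : ℝ → L2 d) (T : ℝ) : Prop
    extends IsSolution μ u T where
  pos : 0 < T
  blowup : strichartzNorm u (Ico 0 T) = ⊤

/-- The decomposition `[0, T) = ⋃ [t_n, t_{n+1})` into intervals on which the diagonal Strichartz
norm of `u` equals `η`. -/
structure IsStrichartzPartition {d : ℕ} (u : ℝ → L2 d) (T η : ℝ) (t : ℕ → ℝ) : Prop where
  zero : t 0 = 0
  strictMono : StrictMono t
  tendsto : Tendsto t atTop (𝓝 T)
  norm_eq : ∀ n, strichartzNorm u (Ioo (t n) (t (n + 1))) = ENNReal.ofReal η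

/-- `I n ⊆ [t_n, t_{n+1})` is an interval (of any kind) of length `σ (t_{n+1} - t_n)`. -/
structure IsThickening (σ : ℝ) (t : ℕ → ℝ) (I : ℕ → Set ℝ) : Prop where
  ordConnected : ∀ n, (I n).OrdConnected
  subset : ∀ n, I n ⊆ Ico (t n) (t (n + 1))
  length : ∀ n, volume (I n) = ENNReal.ofReal (σ * (t (n + 1) - t n))

theorem memLp_indicator_ball {d : ℕ} (R : ℝ) (g : L2 d) :
    MemLp ((Metric.closedBall (0 : Space d) R).indicator (fun ξ => g ξ)) 2 volume :=
  (Lp.memLp g).indicator Metric.isClosed_closedBall.measurableSet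

/-- The Fourier restriction `P_{|ξ| ≤ R}` on `L²(ℝ^d)`: multiplication of the Fourier transform
(with kernel `exp (-2πi x·ξ)`) by the indicator function of the closed ball of radius `R`. -/
def lowFreq {d : ℕ} (R : ℝ) (f : L2 d) : L2 d :=
  𝓕⁻ (memLp_indicator_ball R (𝓕 f : L2 d)).toLp

/-- `κ(ε) = 2^{-(d+2)} (ε ‖u₀‖^{-2} / 8)^{1/d}`, where `m` stands for `‖u₀‖`. -/
def kappa (d : ℕ) (m ε : ℝ) : ℝ := (2 ^ (d + 2))⁻¹ * (ε * (m ^ 2)⁻¹ / 8) ^ (1 / (d : ℝ))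

/-- The frequency cut-off `L(t) = κ(ε) / (2 (T - t)^α)`. -/
def cutoff {d : ℕ} (u : ℝ → L2 d) (T α ε t : ℝ) : ℝ :=
  1 / 2 * kappa d ‖u 0‖ ε / (T - t) ^ α

/-- The cube with corner `a` and side length `l`. -/
def cube {d : ℕ} (a : Space d) (l : ℝ) : Set (Space d) := {x | ∀ i, x i ∈ Ico (a i) (a i + l)}

/-- The supremum of `∫_J |P_{L(t)} u(t, x)|² dx` over the cubes `J` of side length
`l(J) < (T - t)^α`. -/
def concentration {d : ℕ} (u : ℝ → L2 d) (T α ε t : ℝ) : ℝ≥0∞ :=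
  ⨆ (a : Space d) (l : ℝ) (_ : 0 < l ∧ l < (T - t) ^ α),
    ∫⁻ x in cube a l, ‖lowFreq (cutoff u T α ε t) (u t) x‖ₑ ^ 2

/-- Frequency-localized mass concentration of size `(1 - σ') ε`, persisting on the intervals
`I n`. -/
def PersistentConcentration {d : ℕ} (u : ℝ → L2 d) (T α ε σ' : ℝ) (I : ℕ → Set ℝ) : Prop :=
  ENNReal.ofReal ((1 - σ') * ε) ≤ liminf (fun n => ⨅ t ∈ I n, concentration u T α ε t) atTop

end CriticalNLS

end

noncomputable section

namespace CriticalNLS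

open SchwartzMap ComplexConjugate Laplacian

/-! ### The Strichartz exponent and the spatial `L^q` functional -/

/-! Write `spacePow (u s)` for `∫ |u(s, x)|^q dx`. Then `F` is the primitive of `spacePow (u ·)`, so
by Lebesgue differentiation `F' = spacePow (u s)` for a.e. `s`, and everything reduces to a
pointwise bound `spacePow (u s) ≥ c (T - s)^(-2α)` at the times where mass concentrates.

This bound (`exists_spacePow_lower_bound`) is a Bernstein argument. If `P_{ρ/l} w` carries mass `a`
in a cube of side less than `l`, then its sup norm is at least `√a l^(-d/2)`. The sup norm is
bounded above by splitting the sharp multiplier into a smooth cutoff `χ` and a remainder of `L²`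
norm at most `δ`. The remainder contributes `(ρ/l)^(d/2) δ m`, where `m` bounds the `L²` norm of
`w`, and the smooth part contributes `(ρ/l)^(d/q) A ‖w‖_q` by Hölder. With `ρ = κ/2` the quantity
`ρ^d m²` depends only on `d` and `ε`, so one `δ` lets the first term be absorbed for every solution;
what is left bounds `‖w‖_q^q` below by a multiple of `l^(-2)`.

To take `m = ‖u 0‖` at every time one needs conservation of mass (`IsSolution.norm_eq`). For the
weak formulation it is proved by mollifying in space: the mollified solution is absolutely
continuous in time at each point. In the time derivative of its mass the Laplacian contributes
nothing, the kernels being real and even, and the nonlinear part tends to `Im ∫ |u|^q = 0`.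

For the integrated bounds, `F` grows by exactly `η^q` over `[t_n, t_{n+1})`, while the pointwise
bound on `I n` makes this at least `cσ (x_n - x_{n+1}) / x_n^(2α)` with `x_n = T - t_n`. As long as
`x_{n+1} ≥ x_n / 2`, that quantity dominates a multiple of the increment of `x^(1-2α)`, or of `-log
x` when `α = 1/2`, and the increments telescope. -/

theorem strichartzExponent_eq {d : ℕ} (hd : 1 ≤ d) : strichartzExponent d = 2 + 4 / d := by
  have : (d : ℝ) ≠ 0 := by positivity
  unfold strichartzExponent
  field_simp
  ring

theorem two_lt_strichartzExponent {d : ℕ} (hd : 1 ≤ d) : 2 < strichartzExponent d := by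
  rw [strichartzExponent_eq hd]
  have : (0 : ℝ) < 4 / d := by positivity
  linarith

theorem strichartzExponent_pos {d : ℕ} (hd : 1 ≤ d) : 0 < strichartzExponent d :=
  by linarith [two_lt_strichartzExponent hd]

/-- `∫ |g|^q` for `g ∈ L²`. -/
def spacePow {d : ℕ} (g : L2 d) : ℝ≥0∞ := ∫⁻ x, ‖g x‖ₑ ^ strichartzExponent d

theorem strichartzPow_eq {d : ℕ} (u : ℝ → L2 d) (A : Set ℝ) :
    strichartzPow u A = ∫⁻ s in A, spacePow (u s) := rfl

/-- Fatou along a subsequence converging almost everywhere. The integrand may depend on `x` so that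
the lemma also covers the parts of a mollified nonlinearity. -/
theorem lowerSemicontinuous_lintegral_comp {d : ℕ} {θ : Space d → ℂ → ℝ≥0∞}
    (hθ : ∀ x, Continuous (θ x)) (hθm : Measurable (Function.uncurry θ)) :
    LowerSemicontinuous fun g : L2 d => ∫⁻ x, θ x (g x) := by
  rw [lowerSemicontinuous_iff_isClosed_preimage]
  intro y
  refine IsSeqClosed.isClosed fun g g₀ hg hlim => ?_
  obtain ⟨ns, -, hns⟩ := (tendstoInMeasure_of_tendsto_Lp hlim).exists_seq_tendsto_ae
  have hmeas (h : L2 d) : Measurable fun x => θ x (h x) :=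
    hθm.comp (measurable_id.prodMk (Lp.stronglyMeasurable h).measurable)
  change ∫⁻ x, θ x (g₀ x) ≤ y
  calc ∫⁻ x, θ x (g₀ x)
      = ∫⁻ x, liminf (fun i => θ x (g (ns i) x)) atTop := by
        refine lintegral_congr_ae ?_
        filter_upwards [hns] with x hx
        exact ((((hθ x).tendsto _).comp hx).liminf_eq).symm
    _ ≤ liminf (fun i => ∫⁻ x, θ x (g (ns i) x)) atTop := lintegral_liminf_le fun i => hmeas _
    _ ≤ y := liminf_le_of_frequently_le' (Frequently.of_forall fun i => hg _)

theorem lowerSemicontinuous_spacePow {d : ℕ} : LowerSemicontinuous (spacePow (d := d)) :=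
  lowerSemicontinuous_lintegral_comp (θ := fun _ z => ‖z‖ₑ ^ strichartzExponent d)
    (fun _ => ENNReal.continuous_rpow_const.comp continuous_enorm)
    (measurable_snd.enorm.pow_const _)

/-- The representatives of `u s` are chosen separately for each time, so joint measurability in `(s,
x)` is not available. Measurability in time comes from lower semicontinuity on `L²` composed with
the continuous curve. -/
theorem aemeasurable_spacePow {d : ℕ} {u : ℝ → L2 d} {s : Set ℝ} (hu : ContinuousOn u s)
    (hs : MeasurableSet s) : AEMeasurable (fun τ => spacePow (u τ)) (volume.restrict s) := by
  let _ : MeasurableSpace (L2 d) := borel _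
  have _ : BorelSpace (L2 d) := ⟨rfl⟩
  exact lowerSemicontinuous_spacePow.measurable.comp_aemeasurable (hu.aemeasurable hs)

/-! ### The function `F` -/

section Growth

variable {d : ℕ} {μ : ℝ} {u : ℝ → L2 d} {T η : ℝ}

theorem IsSolution.strichartzPow_lt_top (hd : 1 ≤ d) (h : IsSolution μ u T) {t : ℝ}
    (ht : t ∈ Ico 0 T) : strichartzPow u (Icc 0 t) < ⊤ := by
  have h1 := h.strichartz_lt_top t ht
  by_contra h2
  rw [not_lt, top_le_iff] at h2
  rw [strichartzNorm, h2, ENNReal.top_rpow_of_pos (by have := strichartzExponent_pos hd; positivity)]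
    at h1
  exact lt_irrefl _ h1

theorem IsSolution.integrableOn_spacePow (hd : 1 ≤ d) (h : IsSolution μ u T) {t : ℝ}
    (ht : t ∈ Ico 0 T) : IntegrableOn (fun s => (spacePow (u s)).toReal) (Icc 0 t) :=
  integrable_toReal_of_lintegral_ne_top
    (aemeasurable_spacePow (h.continuousOn.mono (Icc_subset_Ico_right ht.2)) measurableSet_Icc)
    (h.strichartzPow_lt_top hd ht).ne

theorem IsSolution.ae_spacePow_lt_top (hd : 1 ≤ d) (h : IsSolution μ u T) {t : ℝ}
    (ht : t ∈ Ico 0 T) : ∀ᵐ s ∂volume.restrict (Icc 0 t), spacePow (u s) < ⊤ :=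
  ae_lt_top'
    (aemeasurable_spacePow (h.continuousOn.mono (Icc_subset_Ico_right ht.2)) measurableSet_Icc)
    (h.strichartzPow_lt_top hd ht).ne

theorem IsSolution.F_eq_integral (hd : 1 ≤ d) (h : IsSolution μ u T) {t : ℝ} (ht : t ∈ Ico 0 T) :
    F u t = ∫ s in (0 : ℝ)..t, (spacePow (u s)).toReal := by
  rw [intervalIntegral.integral_of_le ht.1, ← integral_Icc_eq_integral_Ioc, integral_toReal
    (aemeasurable_spacePow (h.continuousOn.mono (Icc_subset_Ico_right ht.2)) measurableSet_Icc)
    (h.ae_spacePow_lt_top hd ht)]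
  rfl

/-- Lebesgue differentiation of the primitive. The interval is open because `F` must agree with the
primitive on a two-sided neighbourhood. -/
theorem IsSolution.ae_hasDerivAt_F (hd : 1 ≤ d) (h : IsSolution μ u T) {b : ℝ} (hb : b ∈ Ico 0 T) :
    ∀ᵐ s ∂volume.restrict (Ioo 0 b),
      spacePow (u s) < ⊤ ∧ HasDerivAt (F u) (spacePow (u s)).toReal s := by
  have hint : IntervalIntegrable (fun s => (spacePow (u s)).toReal) volume 0 b :=
    (intervalIntegrable_iff_integrableOn_Icc_of_le hb.1).2 (h.integrableOn_spacePow hd hb)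
  rw [ae_restrict_iff' measurableSet_Ioo]
  filter_upwards [hint.ae_hasDerivAt_integral,
    (ae_restrict_iff' measurableSet_Icc).1 (h.ae_spacePow_lt_top hd hb)] with s hs hs' hs0
  refine ⟨hs' (Ioo_subset_Icc_self hs0), ?_⟩
  have h1 := hs (by rw [uIcc_of_le hb.1]; exact Ioo_subset_Icc_self hs0) 0 left_mem_uIcc
  refine h1.congr_of_eventuallyEq ?_
  filter_upwards [Ioo_mem_nhds hs0.1 hs0.2] with r hr
  exact h.F_eq_integral hd ⟨hr.1.le, hr.2.trans hb.2⟩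

theorem IsSolution.F_mono (hd : 1 ≤ d) (h : IsSolution μ u T) {s t : ℝ} (hst : s ≤ t)
    (ht : t ∈ Ico 0 T) : F u s ≤ F u t :=
  ENNReal.toReal_mono (h.strichartzPow_lt_top hd ht).ne
    (lintegral_mono_set (Icc_subset_Icc_right hst))

theorem F_nonneg (u : ℝ → L2 d) (t : ℝ) : 0 ≤ F u t := ENNReal.toReal_nonneg

theorem IsStrichartzPartition.nonneg {t : ℕ → ℝ} (hp : IsStrichartzPartition u T η t) (n : ℕ) :
    0 ≤ t n := by
  rw [← hp.zero]
  exact hp.strictMono.monotone n.zero_le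

theorem IsStrichartzPartition.lt {t : ℕ → ℝ} (hp : IsStrichartzPartition u T η t) (n : ℕ) :
    t n < T :=
  (hp.strictMono n.lt_succ_self).trans_le
    (hp.strictMono.monotone.ge_of_tendsto hp.tendsto (n + 1))

theorem IsStrichartzPartition.mem {t : ℕ → ℝ} (hp : IsStrichartzPartition u T η t) (n : ℕ) :
    t n ∈ Ico 0 T := ⟨hp.nonneg n, hp.lt n⟩

theorem IsStrichartzPartition.pow_eq (hd : 1 ≤ d) (hη : 0 < η) {t : ℕ → ℝ}
    (hp : IsStrichartzPartition u T η t) (n : ℕ) :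
    strichartzPow u (Ioo (t n) (t (n + 1))) = ENNReal.ofReal (η ^ strichartzExponent d) := by
  have h1 := hp.norm_eq n
  have hq := strichartzExponent_pos hd
  rw [← ENNReal.ofReal_rpow_of_pos hη, ← h1, strichartzNorm, ← ENNReal.rpow_mul,
    one_div_mul_cancel hq.ne', ENNReal.rpow_one]

theorem IsStrichartzPartition.F_succ (hd : 1 ≤ d) (h : IsSolution μ u T) (hη : 0 < η) {t : ℕ → ℝ}
    (hp : IsStrichartzPartition u T η t) (n : ℕ) :
    F u (t (n + 1)) = F u (t n) + η ^ strichartzExponent d := by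
  have hlt := hp.strictMono n.lt_succ_self
  have h1 : strichartzPow u (Icc 0 (t (n + 1)))
      = strichartzPow u (Icc 0 (t n)) + strichartzPow u (Ioo (t n) (t (n + 1))) := by
    rw [← Icc_union_Ioc_eq_Icc (hp.nonneg n) hlt.le, strichartzPow, lintegral_union
      measurableSet_Ioc (by
        rw [Set.disjoint_left]
        intro x hx hx'
        exact absurd hx.2 (not_le.2 hx'.1)), ← restrict_Ioo_eq_restrict_Ioc]
    rfl
  rw [F, h1, hp.pow_eq hd hη, ENNReal.toReal_add (h.strichartzPow_lt_top hd (hp.mem n)).ne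
    ENNReal.ofReal_ne_top, ENNReal.toReal_ofReal (by positivity)]
  rfl

/-- A pointwise lower bound on `I n` bounds the length of `[t_n, t_{n+1})`. -/
theorem IsStrichartzPartition.step_le (hd : 1 ≤ d) (hη : 0 < η) {t : ℕ → ℝ}
    (hp : IsStrichartzPartition u T η t) {I : ℕ → Set ℝ} {σ : ℝ}
    (hI : IsThickening σ t I) {α c : ℝ} (hα : 0 ≤ α) (hc : 0 < c) {n : ℕ}
    (hlow : ∀ s ∈ I n, ENNReal.ofReal (c / (T - s) ^ (2 * α)) ≤ spacePow (u s)) :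
    c * σ * ((T - t n) - (T - t (n + 1))) / (T - t n) ^ (2 * α) ≤ η ^ strichartzExponent d := by
  have hx : 0 < T - t n := sub_pos.2 (hp.lt n)
  have hq := Real.rpow_nonneg hη.le (strichartzExponent d)
  rw [← ENNReal.ofReal_le_ofReal_iff hq, ← hp.pow_eq hd hη n, strichartzPow_eq,
    setLIntegral_congr Ioo_ae_eq_Ico]
  have hmeas : MeasurableSet (I n) := (hI.ordConnected n).measurableSet
  calc ENNReal.ofReal (c * σ * ((T - t n) - (T - t (n + 1))) / (T - t n) ^ (2 * α))
      = ENNReal.ofReal (c / (T - t n) ^ (2 * α)) * volume (I n) := by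
        rw [hI.length n, ← ENNReal.ofReal_mul (by positivity)]
        congr 1
        ring
    _ = ∫⁻ _ in I n, ENNReal.ofReal (c / (T - t n) ^ (2 * α)) := by
        rw [setLIntegral_const]
    _ ≤ ∫⁻ s in I n, spacePow (u s) := by
        refine setLIntegral_mono' hmeas fun s hs => le_trans ?_ (hlow s hs)
        have hs' := hI.subset n hs
        have : 0 < T - s := sub_pos.2 (hs'.2.trans (hp.lt _))
        refine ENNReal.ofReal_le_ofReal (div_le_div_of_nonneg_left hc.le (by positivity) ?_)
        exact Real.rpow_le_rpow this.le (by linarith [hs'.1]) (by positivity)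
    _ ≤ ∫⁻ s in Ico (t n) (t (n + 1)), spacePow (u s) := lintegral_mono_set (hI.subset n)

end Growth

/-! ### Summation of the increments -/

theorem le_of_telescoping {A g : ℕ → ℝ} {k : ℝ} {n₀ : ℕ}
    (h : ∀ n, n₀ ≤ n → k * (g (n + 1) - g n) ≤ A (n + 1) - A n) {n : ℕ} (hn : n₀ ≤ n) :
    k * g n + (A n₀ - k * g n₀) ≤ A n := by
  induction n, hn using Nat.le_induction with
  | base => linarith
  | succ n hn ih => linarith [h n hn]

/-- Mean value theorem; `y ≥ x / 2` moves the derivative from `y` to `x` at the price of `2 ^ (p +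
1)`. -/
theorem rpow_neg_sub_rpow_neg_le {p x y : ℝ} (hp : 0 < p) (hy : 0 < y) (hyx : y ≤ x)
    (hxy : x / 2 ≤ y) :
    y ^ (-p) - x ^ (-p) ≤ p * 2 ^ (p + 1) * ((x - y) / x ^ (p + 1)) := by
  have hx : 0 < x := hy.trans_le hyx
  have h1 : y ^ (-p) - x ^ (-p) ≤ p * y ^ (-p - 1) * (x - y) := by
    rcases hyx.eq_or_lt with rfl | hlt
    · simp
    · obtain ⟨ξ, hξ, h⟩ := exists_deriv_eq_slope (fun z : ℝ => z ^ (-p)) hlt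
        (fun z hz => (Real.continuousAt_rpow_const _ _
          (Or.inl (hy.trans_le hz.1).ne')).continuousWithinAt)
        (fun z hz => (Real.differentiableAt_rpow_const_of_ne _
          (hy.trans hz.1).ne').differentiableWithinAt)
      have hξ0 : 0 < ξ := hy.trans hξ.1
      rw [Real.deriv_rpow_const, eq_div_iff (sub_pos.2 hlt).ne'] at h
      have h2 : ξ ^ (-p - 1) ≤ y ^ (-p - 1) :=
        Real.rpow_le_rpow_of_nonpos hy hξ.1.le (by linarith)
      have h3 : p * ξ ^ (-p - 1) * (x - y) ≤ p * y ^ (-p - 1) * (x - y) := by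
        have := sub_nonneg.2 hyx
        gcongr
      linarith
  have h2 : y ^ (-p - 1) ≤ 2 ^ (p + 1) * x ^ (-(p + 1)) := by
    calc y ^ (-p - 1) ≤ (x / 2) ^ (-p - 1) :=
          Real.rpow_le_rpow_of_nonpos (by positivity) hxy (by linarith)
      _ = 2 ^ (p + 1) * x ^ (-(p + 1)) := by
          rw [Real.div_rpow hx.le (by norm_num), show -p - 1 = -(p + 1) by ring,
            Real.rpow_neg (by norm_num : (0 : ℝ) ≤ 2)]
          field_simp
  calc y ^ (-p) - x ^ (-p) ≤ p * y ^ (-p - 1) * (x - y) := h1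
    _ ≤ p * (2 ^ (p + 1) * x ^ (-(p + 1))) * (x - y) := by
        have := sub_nonneg.2 hyx
        gcongr
    _ = _ := by
        rw [Real.rpow_neg hx.le]
        ring

theorem neg_log_sub_neg_log_le {x y : ℝ} (hy : 0 < y) (hyx : y ≤ x) (hxy : x / 2 ≤ y) :
    -Real.log y - -Real.log x ≤ 2 * ((x - y) / x) := by
  have hx : 0 < x := hy.trans_le hyx
  have h1 : Real.log (x / y) ≤ x / y - 1 := Real.log_le_sub_one_of_pos (by positivity)
  rw [Real.log_div hx.ne' hy.ne'] at h1
  have h2 : x / y - 1 ≤ 2 * ((x - y) / x) := by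
    rw [div_sub_one hy.ne', ← mul_div_assoc, div_le_div_iff₀ hy hx]
    have := sub_nonneg.2 hyx
    nlinarith
  linarith

section Sum

variable {d : ℕ} {μ : ℝ} {u : ℝ → L2 d} {T η σ c : ℝ} {t : ℕ → ℝ} {I : ℕ → Set ℝ}

/-- From the step inequality to a lower bound for `F`: `g` is the profile of the bound, which
grows by at most `B` over each of the late steps, `G` is the bound itself. -/
theorem exists_lower_bound_of_step (hd : 1 ≤ d) (h : IsSolution μ u T) (hη : 0 < η)
    (hp : IsStrichartzPartition u T η t) (hI : IsThickening σ t I)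
    {G g : ℝ → ℝ} {k K : ℝ}
    (hstep : ∀ᶠ n in atTop, k * (g (T - t (n + 1)) - g (T - t n)) ≤ η ^ strichartzExponent d)
    (hG : ∀ᶠ n in atTop, ∀ s ∈ I n, G s ≤ k * g (T - t n) + K)
    (hbdd : ∀ n, ∃ B, ∀ s ∈ Icc 0 (t n), G s ≤ B) :
    ∃ C : ℝ, ∀ n, ∀ s ∈ I n, G s + C ≤ F u s := by
  obtain ⟨n₀, hn₀⟩ := eventually_atTop.1 (hstep.and hG)
  obtain ⟨B, hB⟩ := hbdd n₀
  set C₀ := F u (t n₀) - k * g (T - t n₀)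
  -- `-B` serves the finitely many early intervals, where only `F ≥ 0` is used. `C₀ - K` serves the
  -- late ones, where `F s ≥ F (t n)` and the increments telescope from `n₀`.
  refine ⟨min (-B) (C₀ - K), fun n s hs => ?_⟩
  have hs' := hI.subset n hs
  rcases lt_or_ge n n₀ with hn | hn
  · have h1 := hB s ⟨(hp.nonneg n).trans hs'.1,
      hs'.2.le.trans (hp.strictMono.monotone (Nat.succ_le_of_lt hn))⟩
    have := min_le_left (-B) (C₀ - K)
    linarith [F_nonneg u s]
  · have h1 := le_of_telescoping (A := fun n => F u (t n)) (g := fun n => g (T - t n)) (k := k)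
      (n₀ := n₀) (fun n hn => by
        have := (hn₀ n hn).1
        have h2 := hp.F_succ hd h hη n
        linarith) hn
    have h2 := (hn₀ n hn).2 s hs
    have h3 := min_le_right (-B) (C₀ - K)
    have h4 := h.F_mono hd hs'.1 ⟨(hp.nonneg n).trans hs'.1, hs'.2.trans (hp.lt _)⟩
    simp only [C₀] at *
    linarith

theorem IsStrichartzPartition.tendsto_sub (hp : IsStrichartzPartition u T η t) :
    Tendsto (fun n => T - t n) atTop (𝓝 0) := by
  simpa using hp.tendsto.const_sub T

/-- For `α > 1/2` the steps cannot more than halve the remaining time once `n` is large. The last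
factor `2 ^ (2 * α - 1)` in the constant pays for comparing `T - s` with `T - t n` inside an
interval. -/
theorem exists_power_lower_bound (hd : 1 ≤ d) (h : IsSolution μ u T) (hη : 0 < η)
    (hp : IsStrichartzPartition u T η t) (hI : IsThickening σ t I) (hσ : 0 < σ) (hc : 0 < c)
    {α : ℝ} (hα : 1 / 2 < α)
    (hstep : ∀ᶠ n in atTop, c * σ * ((T - t n) - (T - t (n + 1))) / (T - t n) ^ (2 * α)
      ≤ η ^ strichartzExponent d) :
    ∃ C : ℝ, ∀ n, ∀ s ∈ I n,
      c * σ / ((2 * α - 1) * 2 ^ (2 * α)) / 2 ^ (2 * α - 1) * (1 / (T - s) ^ (2 * α - 1)) + C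
        ≤ F u s := by
  set p := 2 * α - 1 with hp_def
  have hp0 : 0 < p := by linarith
  have hp1 : 2 * α = p + 1 := by ring
  rw [hp1] at hstep ⊢
  set k := c * σ / (p * 2 ^ (p + 1))
  have hk : 0 < k := by positivity
  have hx (n) : 0 < T - t n := sub_pos.2 (hp.lt n)
  -- The step inequality says that `x_n - x_{n+1}` is at most a constant times `x_n ^ p * x_n`, and
  -- `x_n ^ p` tends to zero because `p > 0`.
  have hhalf : ∀ᶠ n in atTop, (T - t n) / 2 ≤ T - t (n + 1) := by
    have h1 : Tendsto (fun n => η ^ strichartzExponent d / (c * σ) * (T - t n) ^ p) atTop (𝓝 0) := by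
      have := (((Real.continuousAt_rpow_const 0 p (Or.inr hp0.le)).tendsto.comp
        hp.tendsto_sub)).const_mul (η ^ strichartzExponent d / (c * σ))
      simpa [Function.comp_def, Real.zero_rpow hp0.ne'] using this
    filter_upwards [hstep, h1.eventually_lt_const (show (0 : ℝ) < 1 / 2 by norm_num)] with n hn hn'
    have h2 := hx n
    rw [div_le_iff₀ (by positivity), Real.rpow_add h2, Real.rpow_one] at hn
    have h3 : (T - t n) - (T - t (n + 1))
        ≤ (η ^ strichartzExponent d / (c * σ) * (T - t n) ^ p) * (T - t n) := by
      rw [show η ^ strichartzExponent d / (c * σ) * (T - t n) ^ p * (T - t n)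
        = (η ^ strichartzExponent d * ((T - t n) ^ p * (T - t n))) / (c * σ) by ring,
        le_div_iff₀ (by positivity)]
      linarith
    nlinarith
  refine exists_lower_bound_of_step hd h hη hp hI (g := fun x => x ^ (-p)) (k := k) (K := 0)
    ?_ ?_ ?_
  · filter_upwards [hstep, hhalf] with n hn hn'
    have := rpow_neg_sub_rpow_neg_le hp0 (hx (n + 1))
      (by linarith [hp.strictMono n.lt_succ_self]) hn'
    calc k * ((T - t (n + 1)) ^ (-p) - (T - t n) ^ (-p))
        ≤ k * (p * 2 ^ (p + 1) * (((T - t n) - (T - t (n + 1))) / (T - t n) ^ (p + 1))) := by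
          gcongr
      _ = c * σ * ((T - t n) - (T - t (n + 1))) / (T - t n) ^ (p + 1) := by
          simp only [k]
          field_simp
      _ ≤ _ := hn
  · filter_upwards [hhalf] with n hn s hs
    have hs' := hI.subset n hs
    have h1 : (T - t n) / 2 ≤ T - s := by linarith [hs'.2]
    have h2 : (1 : ℝ) / (T - s) ^ p ≤ 2 ^ p * (T - t n) ^ (-p) := by
      have h0 := hx n
      have h3 : ((T - t n) / 2) ^ p ≤ (T - s) ^ p :=
        Real.rpow_le_rpow (by positivity) h1 hp0.le
      calc (1 : ℝ) / (T - s) ^ p ≤ 1 / ((T - t n) / 2) ^ p :=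
            one_div_le_one_div_of_le (by positivity) h3
        _ = _ := by
            rw [Real.div_rpow h0.le (by norm_num), Real.rpow_neg h0.le]
            field_simp
    calc k / 2 ^ p * (1 / (T - s) ^ p) ≤ k / 2 ^ p * (2 ^ p * (T - t n) ^ (-p)) := by gcongr
      _ = k * (T - t n) ^ (-p) + 0 := by field_simp; ring
  · intro n
    refine ⟨k / 2 ^ p * (1 / (T - t n) ^ p), fun s hs => ?_⟩
    have h0 := hx n
    have : (T - t n) ^ p ≤ (T - s) ^ p := Real.rpow_le_rpow h0.le (by linarith [hs.2]) hp0.le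
    gcongr

/-- At `α = 1/2` the step inequality only bounds `(x_n - x_{n+1}) / x_n` by a constant, so the
halving condition has to be assumed. The offset `k * log 2` accounts for `T - s ≥ (T - t n) / 2`. -/
theorem exists_log_lower_bound (hd : 1 ≤ d) (h : IsSolution μ u T) (hη : 0 < η)
    (hp : IsStrichartzPartition u T η t) (hI : IsThickening σ t I) (hσ : 0 < σ) (hc : 0 < c)
    (hstep : ∀ᶠ n in atTop, c * σ * ((T - t n) - (T - t (n + 1))) / (T - t n)
      ≤ η ^ strichartzExponent d)
    (hhalf : ∀ᶠ n in atTop, (T - t n) / 2 ≤ T - t (n + 1)) :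
    ∃ C : ℝ, ∀ n, ∀ s ∈ I n, c * σ / 2 * |Real.log (T - s)| + C ≤ F u s := by
  set k := c * σ / 2
  have hk : 0 < k := by positivity
  have hx (n) : 0 < T - t n := sub_pos.2 (hp.lt n)
  refine exists_lower_bound_of_step hd h hη hp hI (g := fun x => -Real.log x) (k := k)
    (K := k * Real.log 2) ?_ ?_ ?_
  · filter_upwards [hstep, hhalf] with n hn hn'
    have := neg_log_sub_neg_log_le (hx (n + 1)) (by linarith [hp.strictMono n.lt_succ_self]) hn'
    calc k * (-Real.log (T - t (n + 1)) - -Real.log (T - t n))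
        ≤ k * (2 * (((T - t n) - (T - t (n + 1))) / (T - t n))) := by gcongr
      _ = c * σ * ((T - t n) - (T - t (n + 1))) / (T - t n) := by
          simp only [k]
          ring
      _ ≤ _ := hn
  · filter_upwards [hhalf, hp.tendsto_sub.eventually_lt_const one_pos] with n hn hn1 s hs
    have hs' := hI.subset n hs
    have h0 := hx n
    have h1 : (T - t n) / 2 ≤ T - s := by linarith [hs'.2]
    rw [abs_of_nonpos (Real.log_nonpos (by linarith) (by linarith [hs'.1])), ← mul_add]
    have h2 := Real.log_le_log (by positivity) h1
    rw [Real.log_div h0.ne' (by norm_num)] at h2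
    gcongr
    linarith
  · intro n
    have h0 := hx n
    refine ⟨k * (|Real.log (T - t n)| + |Real.log T|), fun s hs => ?_⟩
    have h1 := Real.log_le_log h0 (show T - t n ≤ T - s by linarith [hs.2])
    have h2 := Real.log_le_log (show 0 < T - s by linarith [hs.2]) (show T - s ≤ T by linarith [hs.1])
    gcongr
    rw [abs_le]
    constructor <;>
      linarith [neg_abs_le (Real.log (T - t n)), le_abs_self (Real.log T),
        abs_nonneg (Real.log (T - t n)), abs_nonneg (Real.log T)]

end Sum

/-! ### The inverse Fourier transform on `L¹ ∩ L²` -/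

theorem integral_smul_fourierInv {d : ℕ} {f g : Space d → ℂ} (hf : Integrable f)
    (hg : Integrable g) : ∫ x, 𝓕⁻ f x • g x = ∫ x, f x • 𝓕⁻ g x := by
  have := VectorFourier.integral_fourierIntegral_smul_eq_flip (L := -innerₗ (Space d))
    (μ := volume) (ν := volume) Real.continuous_fourierChar
    (continuous_inner (𝕜 := ℝ) (E := Space d)).neg hf hg
  have hflip : (-innerₗ (Space d)).flip = -innerₗ (Space d) := by
    ext x y
    simp [real_inner_comm]
  rwa [hflip] at this

theorem continuous_fourierInv {d : ℕ} {g : Space d → ℂ} (hg : Integrable g) :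
    Continuous (𝓕⁻ g) :=
  VectorFourier.fourierIntegral_continuous Real.continuous_fourierChar
    (L := -innerₗ (Space d)) (continuous_inner (𝕜 := ℝ) (E := Space d)).neg hg

/-- Both sides are tested against smooth compactly supported functions: the `L²` transform moves
onto the test function as a tempered distribution, the integral transform by Fubini. -/
theorem fourierInv_toLp_ae_eq {d : ℕ} {g : Space d → ℂ} (hg : MemLp g 2 volume)
    (hg1 : Integrable g) : (𝓕⁻ (hg.toLp g) : L2 d) =ᵐ[volume] 𝓕⁻ g := by
  refine ae_eq_of_integral_contDiff_smul_eq ((Lp.memLp _).locallyIntegrable one_le_two)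
    (continuous_fourierInv hg1).locallyIntegrable fun φ hφ hφc => ?_
  have hψ : HasCompactSupport fun x => (φ x : ℂ) := hφc.comp_left (g := ((↑) : ℝ → ℂ)) rfl
  have hψ' : ContDiff ℝ (⊤ : ℕ∞) fun x => (φ x : ℂ) := Complex.ofRealCLM.contDiff.comp hφ
  set ψ := hψ.toSchwartzMap hψ'
  have h1 := congrArg (fun D => D ψ) (Lp.fourierInv_toTemperedDistribution_eq (hg.toLp g))
  simp only [TemperedDistribution.fourierInv_apply, Lp.toTemperedDistribution_apply] at h1
  calc ∫ x, φ x • (𝓕⁻ (hg.toLp g) : L2 d) x = ∫ x, ψ x • (𝓕⁻ (hg.toLp g) : L2 d) x := by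
        refine integral_congr_ae (ae_of_all _ fun x => ?_)
        simp [ψ]
    _ = ∫ x, (𝓕⁻ ψ) x • hg.toLp g x := h1.symm
    _ = ∫ x, 𝓕⁻ (ψ : Space d → ℂ) x • g x := by
        refine integral_congr_ae ?_
        filter_upwards [hg.coeFn_toLp] with x hx
        rw [hx, SchwartzMap.fourierInv_coe]
    _ = ∫ x, ψ x • 𝓕⁻ g x := integral_smul_fourierInv ψ.integrable hg1
    _ = ∫ x, φ x • 𝓕⁻ g x := by
        refine integral_congr_ae (ae_of_all _ fun x => ?_)
        simp [ψ]

theorem integrable_indicator_closedBall {d : ℕ} (R : ℝ) (g : L2 d) :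
    Integrable ((Metric.closedBall (0 : Space d) R).indicator (fun ξ => g ξ)) := by
  rw [integrable_indicator_iff Metric.isClosed_closedBall.measurableSet]
  have : IsFiniteMeasure (volume.restrict (Metric.closedBall (0 : Space d) R)) :=
    isFiniteMeasure_restrict.2 measure_closedBall_lt_top.ne
  exact ((Lp.memLp g).restrict _).integrable one_le_two

theorem lowFreq_ae_eq {d : ℕ} (R : ℝ) (w : L2 d) :
    (lowFreq R w : L2 d) =ᵐ[volume]
      𝓕⁻ ((Metric.closedBall (0 : Space d) R).indicator (fun ξ => (𝓕 w : L2 d) ξ)) :=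
  fourierInv_toLp_ae_eq _ (integrable_indicator_closedBall R _)

theorem lintegral_enorm_sq {d : ℕ} (w : L2 d) : ∫⁻ x, ‖w x‖ₑ ^ 2 = ENNReal.ofReal (‖w‖ ^ 2) := by
  have h := eLpNorm_nnreal_pow_eq_lintegral (f := (w : Space d → ℂ)) (μ := volume)
    (p := 2) two_ne_zero
  rw [ENNReal.ofReal_pow (norm_nonneg _), Lp.norm_def, ENNReal.ofReal_toReal (Lp.eLpNorm_ne_top w)]
  simpa using h.symm

theorem norm_lowFreq_le {d : ℕ} (R : ℝ) (w : L2 d) : ‖lowFreq R w‖ ≤ ‖w‖ := by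
  have h1 : ‖lowFreq R w‖ = ‖(memLp_indicator_ball R (𝓕 w : L2 d)).toLp‖ :=
    (Lp.fourierTransformₗᵢ (Space d) ℂ).symm.norm_map _
  rw [h1, ← Lp.norm_fourier_eq w]
  refine Lp.norm_le_norm_of_ae_le ?_
  filter_upwards [(memLp_indicator_ball R (𝓕 w : L2 d)).coeFn_toLp] with x hx
  rw [hx]
  exact norm_indicator_le_norm_self _ _

/-! ### Scaling -/

theorem lintegral_comp_smul {d : ℕ} (f : Space d → ℝ≥0∞) {r : ℝ} (hr : 0 < r) :
    ∫⁻ x, f (r • x) = ENNReal.ofReal ((r ^ d)⁻¹) * ∫⁻ x, f x := by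
  have h := lintegral_map_equiv (μ := (volume : Measure (Space d))) f
    (Homeomorph.smulOfNeZero r hr.ne').toMeasurableEquiv
  have h2 : Measure.map (Homeomorph.smulOfNeZero r hr.ne').toMeasurableEquiv
      (volume : Measure (Space d)) = Measure.map (r • ·) volume := rfl
  rw [h2, Measure.map_addHaar_smul volume hr.ne', lintegral_smul_measure, finrank_euclideanSpace,
    Fintype.card_fin, abs_of_pos (by positivity)] at h
  exact h.symm

theorem lintegral_add_right {d : ℕ} (f : Space d → ℝ≥0∞) (a : Space d) :
    ∫⁻ x, f (x + a) = ∫⁻ x, f x := lintegral_add_right_eq_self f a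

/-- The modulated dilation `ξ ↦ χ(ξ / R) e^{2πi x·ξ}`. -/
def modulation {d : ℕ} (χ : Space d → ℂ) (R : ℝ) (x ξ : Space d) : ℂ :=
  Real.fourierChar (inner ℝ ξ x) • χ (R⁻¹ • ξ)

theorem hasCompactSupport_modulation {d : ℕ} {χ : Space d → ℂ} (hχ : HasCompactSupport χ) {R : ℝ}
    (hR : 0 < R) (x : Space d) : HasCompactSupport (modulation χ R x) := by
  have h : HasCompactSupport fun ξ : Space d => χ (R⁻¹ • ξ) :=
    hχ.comp_homeomorph (Homeomorph.smulOfNeZero R⁻¹ (inv_pos.2 hR).ne')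
  refine h.mono fun ξ hξ => ?_
  contrapose! hξ
  simp only [Function.mem_support, not_not] at hξ ⊢
  simp [modulation, hξ]

theorem contDiff_modulation {d : ℕ} {χ : Space d → ℂ} (hχ : ContDiff ℝ (⊤ : ℕ∞) χ) (R : ℝ)
    (x : Space d) : ContDiff ℝ (⊤ : ℕ∞) (modulation χ R x) := by
  have : modulation χ R x = fun ξ =>
      Complex.exp ((2 * Real.pi * inner ℝ ξ x : ℝ) * Complex.I) * χ (R⁻¹ • ξ) := by
    ext ξ
    rw [modulation, Circle.smul_def, Real.fourierChar_apply, smul_eq_mul]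
  rw [this]
  refine ContDiff.mul (ContDiff.cexp (ContDiff.mul ?_ contDiff_const))
    (hχ.comp (contDiff_const_smul _))
  exact Complex.ofRealCLM.contDiff.comp
    (contDiff_const.mul (contDiff_id.inner ℝ contDiff_const))

theorem fourier_modulation {d : ℕ} (χ : Space d → ℂ) {R : ℝ} (hR : 0 < R) (x y : Space d) :
    𝓕 (modulation χ R x) y = (R ^ d : ℝ) • 𝓕 χ (R • (y - x)) := by
  simp only [Real.fourier_eq, modulation]
  have h := Measure.integral_comp_smul (volume : Measure (Space d))
    (fun ξ => Real.fourierChar (-inner ℝ ξ (R • (y - x))) • χ ξ) R⁻¹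
  simp only [finrank_euclideanSpace, Fintype.card_fin, inv_pow, inv_inv,
    abs_of_pos (pow_pos hR d)] at h
  rw [← h]
  refine integral_congr_ae (ae_of_all _ fun ξ => ?_)
  simp only [smul_smul, ← AddChar.map_add_eq_mul]
  congr 2
  simp only [inner_smul_left, inner_smul_right, inner_sub_right]
  simp only [RCLike.conj_to_real]
  field_simp
  ring

/-- The pointwise estimate behind the low frequency bound. -/
theorem enorm_fourierInv_indicator_le {d : ℕ} {q q' : ℝ} (hqq : q'.HolderConjugate q)
    {χ : Space d → ℂ} (hχc : HasCompactSupport χ) (hχ : ContDiff ℝ (⊤ : ℕ∞) χ) {R : ℝ} (hR : 0 < R)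
    (w : L2 d) (x : Space d) :
    ‖𝓕⁻ ((Metric.closedBall (0 : Space d) R).indicator (fun ξ => (𝓕 w : L2 d) ξ)) x‖ₑ ≤
      ENNReal.ofReal (R ^ ((d : ℝ) / 2)) *
          (∫⁻ ξ, ‖(Metric.closedBall (0 : Space d) 1).indicator 1 ξ - χ ξ‖ₑ ^ (2 : ℝ)) ^ (1 / 2 : ℝ)
          * ENNReal.ofReal ‖w‖ +
        ENNReal.ofReal (R ^ ((d : ℝ) / q)) * (∫⁻ ξ, ‖𝓕 χ ξ‖ₑ ^ q') ^ (1 / q') *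
          (∫⁻ y, ‖w y‖ₑ ^ q) ^ (1 / q) := by
  set B := (Metric.closedBall (0 : Space d) 1).indicator (1 : Space d → ℂ)
  set W : L2 d := 𝓕 w
  set ψ := (hasCompactSupport_modulation hχc hR x).toSchwartzMap (contDiff_modulation hχ R x)
  have hψ (ξ) : ψ ξ = modulation χ R x ξ := rfl
  have hRd : (0 : ℝ) < R ^ d := by positivity
  -- the decomposition
  have hind (ξ : Space d) : (Metric.closedBall (0 : Space d) R).indicator (fun ξ => W ξ) ξ
      = B (R⁻¹ • ξ) * W ξ := by
    have : R⁻¹ • ξ ∈ Metric.closedBall (0 : Space d) 1 ↔ ξ ∈ Metric.closedBall (0 : Space d) R := by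
      simp only [mem_closedBall_zero_iff, norm_smul, norm_inv, Real.norm_of_nonneg hR.le]
      rw [inv_mul_le_iff₀ hR, mul_one]
    by_cases h : ξ ∈ Metric.closedBall (0 : Space d) R
    · rw [indicator_of_mem h, show B (R⁻¹ • ξ) = 1 from indicator_of_mem (this.2 h) _]
      simp
    · rw [indicator_of_notMem h,
        show B (R⁻¹ • ξ) = 0 from indicator_of_notMem (fun h' => h (this.1 h')) _]
      simp
  have hint1 : Integrable fun ξ => Real.fourierChar (inner ℝ ξ x) •
      (Metric.closedBall (0 : Space d) R).indicator (fun ξ => W ξ) ξ := by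
    have := (Real.fourierIntegral_convergent_iff (-x)).2
      (integrable_indicator_closedBall R W)
    simpa using this
  have hint2 : Integrable fun ξ => ψ ξ * W ξ :=
    (ψ.memLp 2 volume).integrable_mul (Lp.memLp W)
  have hdec : 𝓕⁻ ((Metric.closedBall (0 : Space d) R).indicator (fun ξ => W ξ)) x
      = (∫ ξ, Real.fourierChar (inner ℝ ξ x) • ((B (R⁻¹ • ξ) - χ (R⁻¹ • ξ)) * W ξ))
        + ∫ ξ, ψ ξ * W ξ := by
    rw [Real.fourierInv_eq, ← sub_eq_iff_eq_add, ← integral_sub hint1 hint2]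
    refine integral_congr_ae (ae_of_all _ fun ξ => ?_)
    simp only [hind, hψ, modulation, Circle.smul_def, smul_eq_mul]
    ring
  -- the Plancherel step
  have hpl : ∫ ξ, ψ ξ * W ξ = ∫ y, (𝓕 (modulation χ R x)) y * w y := by
    have h1 := congrArg (fun D => D ψ) (Lp.fourier_toTemperedDistribution_eq w)
    simp only [TemperedDistribution.fourier_apply, Lp.toTemperedDistribution_apply,
      smul_eq_mul] at h1
    rw [← h1, SchwartzMap.fourier_coe]
    rfl
  have hBm : Measurable B := measurable_one.indicator Metric.isClosed_closedBall.measurableSet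
  have hχm : Measurable χ := hχ.continuous.measurable
  rw [hdec]
  -- The remainder is estimated by Cauchy–Schwarz on the Fourier side, where it is small in `L²`;
  -- the smooth part by Hölder on the physical side, where it can see the `L^q` norm of `w`.
  refine (enorm_add_le _ _).trans (add_le_add ?_ ?_)
  · calc ‖∫ ξ, Real.fourierChar (inner ℝ ξ x) • ((B (R⁻¹ • ξ) - χ (R⁻¹ • ξ)) * W ξ)‖ₑ
        ≤ ∫⁻ ξ, ‖B (R⁻¹ • ξ) - χ (R⁻¹ • ξ)‖ₑ * ‖W ξ‖ₑ := by
          refine (enorm_integral_le_lintegral_enorm _).trans (lintegral_mono fun ξ => ?_)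
          rw [Circle.smul_def, smul_eq_mul, enorm_mul, enorm_mul]
          rw [show ‖((Real.fourierChar (inner ℝ ξ x) : Circle) : ℂ)‖ₑ = 1 by
            rw [← ofReal_norm, Circle.norm_coe, ENNReal.ofReal_one], one_mul]
      _ ≤ (∫⁻ ξ, ‖B (R⁻¹ • ξ) - χ (R⁻¹ • ξ)‖ₑ ^ (2 : ℝ)) ^ (1 / 2 : ℝ) *
          (∫⁻ ξ, ‖W ξ‖ₑ ^ (2 : ℝ)) ^ (1 / 2 : ℝ) :=
          ENNReal.lintegral_mul_le_Lp_mul_Lq volume Real.HolderConjugate.two_two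
            (((hBm.comp (measurable_const_smul _)).sub
              (hχm.comp (measurable_const_smul _))).enorm.aemeasurable)
            (Lp.aestronglyMeasurable W).enorm
      _ = _ := by
          congr 1
          · rw [lintegral_comp_smul (fun ξ => ‖B ξ - χ ξ‖ₑ ^ (2 : ℝ)) (inv_pos.2 hR),
              ENNReal.mul_rpow_of_nonneg _ _ (by norm_num),
              ENNReal.ofReal_rpow_of_pos (by positivity)]
            congr 2
            rw [inv_pow, inv_inv, ← Real.rpow_natCast, ← Real.rpow_mul hR.le]
            congr 1
            ring
          · simp only [ENNReal.rpow_ofNat]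
            rw [lintegral_enorm_sq, Lp.norm_fourier_eq,
              ENNReal.ofReal_rpow_of_nonneg (by positivity) (by norm_num), ← Real.sqrt_eq_rpow,
              Real.sqrt_sq (norm_nonneg _)]
  · rw [hpl]
    have hFm : Continuous (𝓕 (modulation χ R x)) := by
      have : 𝓕 (modulation χ R x) = (𝓕 ψ : 𝓢(Space d, ℂ)) := by
        rw [SchwartzMap.fourier_coe]
        rfl
      rw [this]
      exact SchwartzMap.continuous _
    have hq' := hqq.pos
    calc ‖∫ y, (𝓕 (modulation χ R x)) y * w y‖ₑ
        ≤ ∫⁻ y, ‖𝓕 (modulation χ R x) y‖ₑ * ‖w y‖ₑ := by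
          refine (enorm_integral_le_lintegral_enorm _).trans (lintegral_mono fun ξ => ?_)
          rw [enorm_mul]
      _ ≤ (∫⁻ y, ‖𝓕 (modulation χ R x) y‖ₑ ^ q') ^ (1 / q') * (∫⁻ y, ‖w y‖ₑ ^ q) ^ (1 / q) :=
          ENNReal.lintegral_mul_le_Lp_mul_Lq volume hqq hFm.measurable.enorm.aemeasurable
            (Lp.aestronglyMeasurable w).enorm
      _ = _ := by
          congr 1
          have h1 (y : Space d) : ‖𝓕 (modulation χ R x) y‖ₑ ^ q'
              = ENNReal.ofReal ((R ^ d) ^ q') * ‖𝓕 χ (R • (y + -x))‖ₑ ^ q' := by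
            rw [fourier_modulation χ hR, enorm_smul, ENNReal.mul_rpow_of_nonneg _ _ hq'.le,
              Real.enorm_eq_ofReal hRd.le, ENNReal.ofReal_rpow_of_pos hRd, sub_eq_add_neg]
          simp only [h1]
          rw [lintegral_const_mul' _ _ ENNReal.ofReal_ne_top,
            lintegral_add_right (fun y => ‖𝓕 χ (R • y)‖ₑ ^ q') (-x),
            lintegral_comp_smul (fun y => ‖𝓕 χ y‖ₑ ^ q') hR, ← mul_assoc,
            ← ENNReal.ofReal_mul (by positivity),
            ENNReal.mul_rpow_of_nonneg _ _ (by positivity),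
            ENNReal.ofReal_rpow_of_pos (by positivity)]
          congr 2
          have h2 : (R ^ d) ^ q' * (R ^ d)⁻¹ = R ^ ((d : ℝ) * (q' - 1)) := by
            rw [← Real.rpow_natCast, ← Real.rpow_neg hR.le, ← Real.rpow_mul hR.le,
              ← Real.rpow_add hR]
            congr 1
            ring
          rw [h2, ← Real.rpow_mul hR.le]
          congr 1
          have h3 := hqq.inv_add_inv_eq_one
          rw [mul_assoc, div_eq_mul_inv]
          congr 1
          rw [show q⁻¹ = 1 - q'⁻¹ by linarith]
          field_simp

/-! ### Concentration of low frequencies forces a large `L^q` norm -/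

theorem volume_cube {d : ℕ} (x₀ : Space d) (l : ℝ) :
    volume (cube x₀ l) = ENNReal.ofReal l ^ d := by
  have h : cube x₀ l = WithLp.ofLp ⁻¹' (Set.pi univ fun i => Ico (x₀ i) (x₀ i + l)) := by
    ext x
    simp only [cube, mem_ofPred_eq, mem_preimage, Set.mem_pi, mem_univ, true_imp_iff]
  rw [h, (PiLp.volume_preserving_ofLp (Fin d)).measure_preimage
    (MeasurableSet.univ_pi fun i => measurableSet_Ico).nullMeasurableSet, Real.volume_pi_Ico]
  simp

/-- The sharp cutoff cannot be used directly: for `d ≥ 2` the Fourier transform of the indicator of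
the ball decays too slowly to lie in the dual Lebesgue space. A smooth compactly supported `χ` has a
Schwartz transform. -/
theorem exists_smooth_approx_indicator_ball (d : ℕ) {δ : ℝ} (hδ : 0 < δ) :
    ∃ χ : Space d → ℂ, HasCompactSupport χ ∧ ContDiff ℝ (⊤ : ℕ∞) χ ∧
      (∫⁻ ξ, ‖(Metric.closedBall (0 : Space d) 1).indicator 1 ξ - χ ξ‖ₑ ^ (2 : ℝ)) ^ (1 / 2 : ℝ)
        ≤ ENNReal.ofReal δ := by
  have hB : MemLp ((Metric.closedBall (0 : Space d) 1).indicator (1 : Space d → ℂ)) 2 volume :=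
    memLp_indicator_const 2 Metric.isClosed_closedBall.measurableSet (1 : ℂ)
      (Or.inr measure_closedBall_lt_top.ne)
  obtain ⟨χ, hχc, hχ, h⟩ := hB.exist_eLpNorm_sub_le ENNReal.ofNat_ne_top one_le_two hδ
  refine ⟨χ, hχc, hχ, ?_⟩
  rw [eLpNorm_eq_lintegral_rpow_enorm_toReal two_ne_zero ENNReal.ofNat_ne_top] at h
  simpa using h

theorem lintegral_fourier_rpow_lt_top {d : ℕ} {χ : Space d → ℂ} (hχc : HasCompactSupport χ)
    (hχ : ContDiff ℝ (⊤ : ℕ∞) χ) {p : ℝ} (hp : 0 < p) : ∫⁻ ξ, ‖𝓕 χ ξ‖ₑ ^ p < ⊤ := by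
  have h := (𝓕 (hχc.toSchwartzMap hχ)).memLp (ENNReal.ofReal p) volume
  have h2 := lintegral_rpow_enorm_lt_top_of_eLpNorm_lt_top
    (ENNReal.ofReal_pos.2 hp).ne' ENNReal.ofReal_ne_top h.2
  rw [ENNReal.toReal_ofReal hp.le, SchwartzMap.fourier_coe] at h2
  exact h2

/-- The real-variable computation: `R = ρ / l` is the frequency scale, `l` the window. -/
theorem rpow_lower_bound {d : ℕ} (hd : 1 ≤ d) {a K δ A m l ρ W : ℝ} (ha : 0 < a)
    (hδ : δ = √a / (2 * √K)) (hA : 0 < A) (hm : 0 < m) (hl : 0 < l) (hρ : 0 < ρ) (hW : 0 ≤ W)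
    (hK : ρ ^ d * m ^ 2 = K) (ham : a ≤ m ^ 2)
    (h : a ≤ ((ρ / l) ^ ((d : ℝ) / 2) * δ * m
      + (ρ / l) ^ ((d : ℝ) / strichartzExponent d) * A * W) ^ 2 * l ^ d) :
    (√a / (2 * A)) ^ strichartzExponent d * (a / K) / l ^ 2 ≤ W ^ strichartzExponent d := by
  set q := strichartzExponent d with hq_def
  have hq : 0 < q := strichartzExponent_pos hd
  have hK0 : 0 < K := by rw [← hK]; positivity
  have hsa : 0 < √a := Real.sqrt_pos.2 ha
  have hdq : (d : ℝ) / 2 * q = 2 + d := by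
    have : (d : ℝ) ≠ 0 := by positivity
    rw [hq_def, strichartzExponent]
    field_simp
    ring
  have hnn : 0 ≤ (ρ / l) ^ ((d : ℝ) / 2) * δ * m + (ρ / l) ^ ((d : ℝ) / q) * A * W := by
    rw [hδ]
    positivity
  have h1 : √a ≤ ((ρ / l) ^ ((d : ℝ) / 2) * δ * m + (ρ / l) ^ ((d : ℝ) / q) * A * W)
      * l ^ ((d : ℝ) / 2) := by
    rw [← Real.sqrt_sq (mul_nonneg hnn (by positivity))]
    refine Real.sqrt_le_sqrt (h.trans_eq ?_)
    rw [mul_pow, ← Real.rpow_natCast (l ^ _), ← Real.rpow_mul hl.le]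
    congr 1
    rw [← Real.rpow_natCast]
    congr 1
    push_cast
    ring
  -- The powers of `l` cancel and leave `δ √K`, which the choice of `δ` makes exactly half of the
  -- left side of `h1`.
  have h2 : (ρ / l) ^ ((d : ℝ) / 2) * δ * m * l ^ ((d : ℝ) / 2) = √a / 2 := by
    have hsK : √K = ρ ^ ((d : ℝ) / 2) * m := by
      rw [← hK, Real.sqrt_mul (by positivity), Real.sqrt_sq hm.le, Real.sqrt_eq_rpow,
        ← Real.rpow_natCast, ← Real.rpow_mul hρ.le]
      congr 2
      ring
    rw [hδ, hsK, Real.div_rpow hρ.le hl.le]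
    field_simp
  have h3 : √a / (2 * A) ≤ (ρ / l) ^ ((d : ℝ) / q) * l ^ ((d : ℝ) / 2) * W := by
    rw [add_mul, h2] at h1
    rw [div_le_iff₀ (by positivity)]
    linarith
  have h4 := Real.rpow_le_rpow (by positivity) h3 hq.le
  rw [Real.mul_rpow (by positivity) hW, Real.mul_rpow (by positivity) (by positivity),
    ← Real.rpow_mul (by positivity), ← Real.rpow_mul hl.le, div_mul_cancel₀ _ hq.ne', hdq,
    Real.rpow_natCast, Real.rpow_add hl, Real.rpow_natCast, Real.rpow_two, div_pow] at h4
  have h5 : ρ ^ d / l ^ d * (l ^ 2 * l ^ d) * W ^ q = ρ ^ d * l ^ 2 * W ^ q := by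
    field_simp
  rw [h5] at h4
  -- Since `K = ρ ^ d * m ^ 2 ≥ ρ ^ d * a`, the factor `ρ ^ d`, which depends on the mass, is
  -- replaced by the constant `K / a`.
  have hρK : ρ ^ d * (a / K) ≤ 1 := by
    rw [← mul_div_assoc, div_le_one hK0, ← hK]
    gcongr
  rw [div_le_iff₀ (by positivity)]
  calc (√a / (2 * A)) ^ q * (a / K) ≤ (ρ ^ d * l ^ 2 * W ^ q) * (a / K) := by gcongr
    _ = (ρ ^ d * (a / K)) * (W ^ q * l ^ 2) := by ring
    _ ≤ 1 * (W ^ q * l ^ 2) := by gcongr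
    _ = _ := one_mul _

/-- The purpose of the normalisation of `kappa`: the mass `m` drops out, so the constants below do
not depend on the solution. -/
theorem half_kappa_pow {d : ℕ} (hd : 1 ≤ d) {m ε : ℝ} (hm : 0 < m) (hε : 0 < ε) :
    (1 / 2 * kappa d m ε) ^ d * m ^ 2 = (1 / 2 * (2 ^ (d + 2))⁻¹) ^ d * (ε / 8) := by
  have : (d : ℝ) ≠ 0 := by positivity
  rw [kappa, ← mul_assoc, mul_pow, ← Real.rpow_natCast ((_ : ℝ) ^ (1 / (d : ℝ))),
    ← Real.rpow_mul (by positivity), one_div_mul_cancel this, Real.rpow_one]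
  field_simp

/-- Local mass at low frequency is at most the squared sup norm times the volume of the cube. The
constant is fixed before `w`, `m` and `l`, which is what makes the final `c` uniform in `α` and in
the solution. -/
theorem exists_spacePow_lower_bound {d : ℕ} (hd : 1 ≤ d) {ε a : ℝ} (hε : 0 < ε) (ha : 0 < a) :
    ∃ c : ℝ, 0 < c ∧ ∀ (w : L2 d) (m l : ℝ), ‖w‖ ≤ m → 0 < l →
      (∃ (x₀ : Space d) (r : ℝ), r < l ∧
        ENNReal.ofReal a ≤ ∫⁻ x in cube x₀ r, ‖lowFreq (1 / 2 * kappa d m ε / l) w x‖ₑ ^ 2) →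
      ENNReal.ofReal (c / l ^ 2) ≤ spacePow w := by
  set q := strichartzExponent d with hq_def
  have hq : 0 < q := strichartzExponent_pos hd
  have hqq : q.conjExponent.HolderConjugate q :=
    (Real.HolderConjugate.conjExponent (by linarith [two_lt_strichartzExponent hd])).symm
  set K : ℝ := (1 / 2 * (2 ^ (d + 2))⁻¹) ^ d * (ε / 8)
  have hK : 0 < K := by positivity
  set δ := √a / (2 * √K) with hδ_def
  have hδ : 0 < δ := by positivity
  obtain ⟨χ, hχc, hχ, hχδ⟩ := exists_smooth_approx_indicator_ball d hδ
  have hfin := ENNReal.rpow_lt_top_of_nonneg (y := 1 / q.conjExponent)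
    (one_div_nonneg.2 hqq.nonneg) (lintegral_fourier_rpow_lt_top hχc hχ hqq.pos).ne
  set A' := (∫⁻ ξ, ‖𝓕 χ ξ‖ₑ ^ q.conjExponent) ^ (1 / q.conjExponent)
  -- Adding one keeps `A` positive, as it appears in a denominator.
  set A := A'.toReal + 1
  have hA : 0 < A := by positivity
  have hAA : A' ≤ ENNReal.ofReal A := by
    rw [ENNReal.le_ofReal_iff_toReal_le hfin.ne hA.le]
    linarith
  refine ⟨(√a / (2 * A)) ^ q * (a / K), by positivity, fun w m l hwm hl ⟨x₀, r, hrl, hlow⟩ => ?_⟩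
  set ρ := 1 / 2 * kappa d m ε with hρ_def
  -- Concentrated mass cannot exceed the total mass; in particular `m` is positive and `kappa` is
  -- not degenerate.
  have ham : a ≤ m ^ 2 := by
    have h1 : ENNReal.ofReal a ≤ ENNReal.ofReal (‖lowFreq (ρ / l) w‖ ^ 2) := by
      rw [← lintegral_enorm_sq]
      exact hlow.trans (setLIntegral_le_lintegral _ _)
    rw [ENNReal.ofReal_le_ofReal_iff (by positivity)] at h1
    have h2 := (norm_lowFreq_le (ρ / l) w).trans hwm
    exact h1.trans (by gcongr)
  have hm : 0 < m := by
    rcases ((norm_nonneg w).trans hwm).eq_or_lt with h | h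
    · rw [← h] at ham
      norm_num at ham
      linarith
    · exact h
  have hρ : 0 < ρ := by
    rw [hρ_def, kappa]
    positivity
  rcases eq_or_ne (spacePow w) ⊤ with htop | htop
  · rw [htop]
    exact le_top
  have hWtop : spacePow w ^ (1 / q) ≠ ⊤ := ENNReal.rpow_ne_top_of_nonneg (by positivity) htop
  set W := (spacePow w ^ (1 / q)).toReal
  have hW : spacePow w ^ (1 / q) = ENNReal.ofReal W := (ENNReal.ofReal_toReal hWtop).symm
  have hWq : spacePow w = ENNReal.ofReal (W ^ q) := by
    rw [← ENNReal.ofReal_rpow_of_nonneg ENNReal.toReal_nonneg hq.le, ← hW, ← ENNReal.rpow_mul,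
      one_div_mul_cancel hq.ne', ENNReal.rpow_one]
  have hW0 : 0 ≤ W := ENNReal.toReal_nonneg
  rw [hWq]
  refine ENNReal.ofReal_le_ofReal ?_
  refine rpow_lower_bound hd ha hδ_def hA hm hl hρ hW0 (half_kappa_pow hd hm hε) ham ?_
  rw [← hq_def]
  set b := (ρ / l) ^ ((d : ℝ) / 2) * δ * m + (ρ / l) ^ ((d : ℝ) / q) * A * W
  have hb : 0 ≤ b := by positivity
  have hpt : ∀ᵐ x : Space d, ‖lowFreq (ρ / l) w x‖ₑ ≤ ENNReal.ofReal b := by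
    filter_upwards [lowFreq_ae_eq (ρ / l) w] with x hx
    rw [hx]
    refine (enorm_fourierInv_indicator_le hqq hχc hχ (by positivity) w x).trans ?_
    rw [ENNReal.ofReal_add (by positivity) (by positivity), ENNReal.ofReal_mul (by positivity),
      ENNReal.ofReal_mul (by positivity), ENNReal.ofReal_mul (by positivity),
      ENNReal.ofReal_mul (by positivity)]
    refine add_le_add ?_ ?_
    · gcongr
    · refine mul_le_mul' (mul_le_mul' le_rfl hAA) ?_
      exact hW.le
  have hfinal : ENNReal.ofReal a ≤ ENNReal.ofReal (b ^ 2 * l ^ d) := by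
    calc ENNReal.ofReal a ≤ ∫⁻ x in cube x₀ r, ‖lowFreq (ρ / l) w x‖ₑ ^ 2 := hlow
      _ ≤ ∫⁻ _ in cube x₀ r, ENNReal.ofReal b ^ 2 := by
          refine lintegral_mono_ae (ae_restrict_of_ae ?_)
          filter_upwards [hpt] with x hx
          gcongr
      _ = ENNReal.ofReal b ^ 2 * ENNReal.ofReal r ^ d := by
          rw [setLIntegral_const, volume_cube]
      _ ≤ ENNReal.ofReal b ^ 2 * ENNReal.ofReal l ^ d := by gcongr
      _ = ENNReal.ofReal (b ^ 2 * l ^ d) := by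
          rw [ENNReal.ofReal_mul (by positivity), ENNReal.ofReal_pow hb, ENNReal.ofReal_pow hl.le]
  exact (ENNReal.ofReal_le_ofReal_iff (by positivity)).1 hfinal

/-! ### Mollification and translation correlations -/

/-- The convolution of `f` with a real kernel `k`. -/
def mollify {d : ℕ} (k : Space d → ℝ) (f : Space d → ℂ) (x : Space d) : ℂ :=
  ∫ y, f y * (k (x - y) : ℂ)

/-- The correlation `∫ conj f(x - a) h(x - b) dx`. -/
def correlation {d : ℕ} (f h : Space d → ℂ) (z : Space d × Space d) : ℂ :=
  ∫ x, conj (f (x - z.1)) * h (x - z.2)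

theorem mollify_eq {d : ℕ} (k : Space d → ℝ) (f : Space d → ℂ) (x : Space d) :
    mollify k f x = ∫ a, (k a : ℂ) * f (x - a) := by
  rw [mollify, ← integral_sub_left_eq_self _ volume x]
  simp [mul_comm]

theorem continuous_mollify {d : ℕ} {k : Space d → ℝ} (hk : Continuous k)
    (hkc : HasCompactSupport k) {f : Space d → ℂ} (hf : LocallyIntegrable f) :
    Continuous (mollify k f) :=
  HasCompactSupport.continuous_convolution_right (ContinuousLinearMap.mul ℝ ℂ)
    (g := fun y => (k y : ℂ)) (hkc.comp_left (g := ((↑) : ℝ → ℂ)) rfl) hf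
    (Complex.continuous_ofReal.comp hk)

theorem lintegral_enorm_mul_le {d : ℕ} {p p' : ℝ≥0∞} [p.HolderConjugate p'] {f h : Space d → ℂ}
    (hf : AEStronglyMeasurable f) (hh : AEStronglyMeasurable h) :
    ∫⁻ x, ‖f x‖ₑ * ‖h x‖ₑ ≤ eLpNorm f p * eLpNorm h p' := by
  have := eLpNorm_smul_le_mul_eLpNorm (p := p) (q := p') (r := 1) hh hf
  rw [eLpNorm_one_eq_lintegral_enorm] at this
  simpa [enorm_mul] using this

theorem eLpNorm_comp_sub {d : ℕ} {p : ℝ≥0∞} {f : Space d → ℂ} (hf : AEStronglyMeasurable f)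
    (a : Space d) : eLpNorm (fun x => f (x - a)) p = eLpNorm f p :=
  eLpNorm_comp_measurePreserving hf (measurePreserving_sub_right volume a)

theorem aestronglyMeasurable_comp_sub {d : ℕ} {f : Space d → ℂ} (hf : AEStronglyMeasurable f)
    (a : Space d) : AEStronglyMeasurable fun x => f (x - a) :=
  hf.comp_measurePreserving (measurePreserving_sub_right volume a)

theorem memLp_comp_sub {d : ℕ} {p : ℝ≥0∞} {f : Space d → ℂ} (hf : MemLp f p)
    (a : Space d) : MemLp (fun x => f (x - a)) p :=
  hf.comp_measurePreserving (measurePreserving_sub_right volume a)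

section Expansion

variable {d : ℕ} {p p' : ℝ≥0∞} [p.HolderConjugate p'] {f h : Space d → ℂ} {k₁ k₂ : Space d → ℝ}

/-- The integrand of the expansion of `∫ conj (f * k₁) (h * k₂)`. -/
def expansion (k₁ k₂ : Space d → ℝ) (f h : Space d → ℂ) (x : Space d) (z : Space d × Space d) : ℂ :=
  conj ((k₁ z.1 : ℂ) * f (x - z.1)) * ((k₂ z.2 : ℂ) * h (x - z.2))

theorem stronglyMeasurable_expansion (hk₁ : Continuous k₁) (hk₂ : Continuous k₂)
    (hf : StronglyMeasurable f) (hh : StronglyMeasurable h) :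
    StronglyMeasurable (Function.uncurry (expansion k₁ k₂ f h)) := by
  have hfm := hf.measurable
  have hhm := hh.measurable
  have hk₁m := hk₁.measurable
  have hk₂m := hk₂.measurable
  have : Measurable (Function.uncurry (expansion k₁ k₂ f h)) := by
    unfold Function.uncurry expansion
    refine Measurable.mul (Complex.continuous_conj.measurable.comp (Measurable.mul ?_ ?_))
      (Measurable.mul ?_ ?_)
    · exact Complex.measurable_ofReal.comp (hk₁m.comp (by fun_prop))
    · exact hfm.comp (by fun_prop)
    · exact Complex.measurable_ofReal.comp (hk₂m.comp (by fun_prop))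
    · exact hhm.comp (by fun_prop)
  exact this.stronglyMeasurable

theorem enorm_expansion (k₁ k₂ : Space d → ℝ) (f h : Space d → ℂ) (x : Space d)
    (z : Space d × Space d) : ‖expansion k₁ k₂ f h x z‖ₑ
      = ‖k₁ z.1‖ₑ * ‖k₂ z.2‖ₑ * (‖f (x - z.1)‖ₑ * ‖h (x - z.2)‖ₑ) := by
  have h1 (r : ℝ) : ‖(r : ℂ)‖ₑ = ‖r‖ₑ := by
    rw [← ofReal_norm, ← ofReal_norm, Complex.norm_real]
  simp only [expansion, enorm_mul, RCLike.enorm_conj]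
  rw [h1, h1]
  ring

theorem lintegral_translate_mul_le (hf : AEStronglyMeasurable f) (hh : AEStronglyMeasurable h)
    (a b : Space d) :
    ∫⁻ x, ‖f (x - a)‖ₑ * ‖h (x - b)‖ₑ ≤ eLpNorm f p * eLpNorm h p' := by
  have h1 := lintegral_enorm_mul_le (p := p) (p' := p')
    (aestronglyMeasurable_comp_sub hf a) (aestronglyMeasurable_comp_sub hh b)
  rwa [eLpNorm_comp_sub hf a, eLpNorm_comp_sub hh b] at h1

/-- Integrating in `x` first, Hölder and translation invariance bound the inner integral
independently of the two shifts. -/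
theorem lintegral_expansion_le (hk₁ : Continuous k₁) (hk₂ : Continuous k₂)
    (hf : StronglyMeasurable f) (hh : StronglyMeasurable h) :
    ∫⁻ x, ∫⁻ z, ‖expansion k₁ k₂ f h x z‖ₑ ≤
      (∫⁻ a, ‖k₁ a‖ₑ) * (∫⁻ b, ‖k₂ b‖ₑ) * (eLpNorm f p * eLpNorm h p') := by
  have hm := (stronglyMeasurable_expansion hk₁ hk₂ hf hh).measurable.enorm
  have hk₁m := hk₁.measurable.enorm
  have hk₂m := hk₂.measurable.enorm
  rw [lintegral_lintegral_swap hm.aemeasurable]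
  calc ∫⁻ z, ∫⁻ x, ‖expansion k₁ k₂ f h x z‖ₑ
      ≤ ∫⁻ z : Space d × Space d, ‖k₁ z.1‖ₑ * ‖k₂ z.2‖ₑ * (eLpNorm f p * eLpNorm h p') := by
        refine lintegral_mono fun z => ?_
        simp only [enorm_expansion]
        rw [lintegral_const_mul' _ _ (ENNReal.mul_ne_top enorm_ne_top enorm_ne_top)]
        exact mul_le_mul' le_rfl
          (lintegral_translate_mul_le hf.aestronglyMeasurable hh.aestronglyMeasurable _ _)
    _ = (∫⁻ z : Space d × Space d, ‖k₁ z.1‖ₑ * ‖k₂ z.2‖ₑ) * (eLpNorm f p * eLpNorm h p') :=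
        lintegral_mul_const _ ((hk₁m.comp measurable_fst).mul (hk₂m.comp measurable_snd))
    _ = _ := by
        rw [Measure.volume_eq_prod, lintegral_prod_mul hk₁m.aemeasurable hk₂m.aemeasurable]

theorem integral_expansion (k₁ k₂ : Space d → ℝ) (f h : Space d → ℂ) (x : Space d) :
    ∫ z, expansion k₁ k₂ f h x z = conj (mollify k₁ f x) * mollify k₂ h x := by
  rw [mollify_eq, mollify_eq, ← integral_conj]
  exact integral_prod_mul (μ := (volume : Measure (Space d))) (ν := (volume : Measure (Space d)))
    (fun a => conj ((k₁ a : ℂ) * f (x - a))) (fun b => (k₂ b : ℂ) * h (x - b))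

theorem lintegral_mollify_mul_le (hk₁ : Continuous k₁) (hk₂ : Continuous k₂)
    (hf : StronglyMeasurable f) (hh : StronglyMeasurable h) :
    ∫⁻ x, ‖conj (mollify k₁ f x) * mollify k₂ h x‖ₑ ≤
      (∫⁻ a, ‖k₁ a‖ₑ) * (∫⁻ b, ‖k₂ b‖ₑ) * (eLpNorm f p * eLpNorm h p') := by
  refine le_trans (lintegral_mono fun x => ?_) (lintegral_expansion_le hk₁ hk₂ hf hh)
  rw [← integral_expansion]
  exact enorm_integral_le_lintegral_enorm _

theorem lintegral_enorm_lt_top {k : Space d → ℝ} (hk : Continuous k) (hkc : HasCompactSupport k) :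
    ∫⁻ a, ‖k a‖ₑ < ⊤ := (hk.integrable_of_hasCompactSupport hkc).hasFiniteIntegral

theorem integrable_expansion (hk₁ : Continuous k₁) (hk₂ : Continuous k₂)
    (hk₁c : HasCompactSupport k₁) (hk₂c : HasCompactSupport k₂)
    (hf : StronglyMeasurable f) (hh : StronglyMeasurable h) (hfp : MemLp f p) (hhp : MemLp h p') :
    Integrable (Function.uncurry (expansion k₁ k₂ f h))
      ((volume : Measure (Space d)).prod (volume : Measure (Space d × Space d))) := by
  have hm := stronglyMeasurable_expansion hk₁ hk₂ hf hh
  refine ⟨hm.aestronglyMeasurable, ?_⟩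
  rw [hasFiniteIntegral_iff_enorm, lintegral_prod _ hm.measurable.enorm.aemeasurable]
  refine (lintegral_expansion_le (p := p) (p' := p') hk₁ hk₂ hf hh).trans_lt ?_
  exact ENNReal.mul_lt_top (ENNReal.mul_lt_top (lintegral_enorm_lt_top hk₁ hk₁c)
    (lintegral_enorm_lt_top hk₂ hk₂c)) (ENNReal.mul_lt_top hfp.2 hhp.2)

theorem integral_expansion_left (k₁ k₂ : Space d → ℝ) (f h : Space d → ℂ)
    (z : Space d × Space d) :
    ∫ x, expansion k₁ k₂ f h x z = (k₁ z.1 * k₂ z.2 : ℝ) • correlation f h z := by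
  rw [correlation, ← integral_smul]
  refine integral_congr_ae (ae_of_all _ fun x => ?_)
  simp only [expansion, map_mul, Complex.conj_ofReal, Complex.real_smul, Complex.ofReal_mul]
  ring

theorem integrable_smul_correlation (hk₁ : Continuous k₁) (hk₂ : Continuous k₂)
    (hk₁c : HasCompactSupport k₁) (hk₂c : HasCompactSupport k₂)
    (hf : StronglyMeasurable f) (hh : StronglyMeasurable h) (hfp : MemLp f p) (hhp : MemLp h p') :
    Integrable fun z : Space d × Space d => (k₁ z.1 * k₂ z.2 : ℝ) • correlation f h z := by
  have := (integrable_expansion hk₁ hk₂ hk₁c hk₂c hf hh hfp hhp).integral_prod_right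
  simpa only [Function.uncurry, integral_expansion_left] using this

theorem integrable_mollify_mul (hk₁ : Continuous k₁) (hk₂ : Continuous k₂)
    (hk₁c : HasCompactSupport k₁) (hk₂c : HasCompactSupport k₂)
    (hf : StronglyMeasurable f) (hh : StronglyMeasurable h) (hfp : MemLp f p) (hhp : MemLp h p') :
    Integrable fun x => conj (mollify k₁ f x) * mollify k₂ h x := by
  have := (integrable_expansion hk₁ hk₂ hk₁c hk₂c hf hh hfp hhp).integral_prod_left
  simpa only [Function.uncurry, integral_expansion] using this

/-- Fubini turns the pairing of two mollified functions into an average of translation correlations.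
Symmetry and convergence are then read off from the correlation, without differentiating `f` or `h`.
-/
theorem integral_mollify_mul (hk₁ : Continuous k₁) (hk₂ : Continuous k₂)
    (hk₁c : HasCompactSupport k₁) (hk₂c : HasCompactSupport k₂)
    (hf : StronglyMeasurable f) (hh : StronglyMeasurable h) (hfp : MemLp f p) (hhp : MemLp h p') :
    ∫ x, conj (mollify k₁ f x) * mollify k₂ h x
      = ∫ z : Space d × Space d, (k₁ z.1 * k₂ z.2 : ℝ) • correlation f h z := by
  simp only [← integral_expansion, ← integral_expansion_left]
  exact integral_integral_swap (integrable_expansion hk₁ hk₂ hk₁c hk₂c hf hh hfp hhp)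

end Expansion

/-! ### Real convolution operators with even kernels are symmetric and commute -/

/-- Translate the variable by `z.1 + z.2`; this exchanges the two shifts. -/
theorem correlation_neg {d : ℕ} (f : Space d → ℂ) (z : Space d × Space d) :
    correlation f f (-z) = conj (correlation f f z) := by
  simp only [correlation, Prod.fst_neg, Prod.snd_neg, sub_neg_eq_add]
  rw [← integral_conj, ← integral_sub_right_eq_self _ (z.1 + z.2)]
  refine integral_congr_ae (ae_of_all _ fun x => ?_)
  simp only [map_mul, Complex.conj_conj]
  rw [show x - (z.1 + z.2) + z.1 = x - z.2 by abel, show x - (z.1 + z.2) + z.2 = x - z.1 by abel]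
  ring

theorem integral_neg_prod {d : ℕ} (g : Space d × Space d → ℂ) : ∫ z, g (-z) = ∫ z, g z := by
  have h1 : MeasurePreserving (fun z : Space d × Space d => -z) :=
    (Measure.measurePreserving_neg (volume : Measure (Space d))).prod
      (Measure.measurePreserving_neg (volume : Measure (Space d)))
  exact h1.integral_comp (MeasurableEquiv.neg _).measurableEmbedding g

/-- The substitution `z ↦ -z` fixes the even weights and conjugates the correlation. With `k₂ = Δ
k₁` this replaces integration by parts in the kinetic term. -/
theorem im_integral_mollify_mul {d : ℕ} {k₁ k₂ : Space d → ℝ} (hk₁ : Continuous k₁)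
    (hk₂ : Continuous k₂) (hk₁c : HasCompactSupport k₁) (hk₂c : HasCompactSupport k₂)
    (hk₁e : ∀ x, k₁ (-x) = k₁ x) (hk₂e : ∀ x, k₂ (-x) = k₂ x) {f : Space d → ℂ}
    (hf : StronglyMeasurable f) (hf2 : MemLp f 2) :
    (∫ x, conj (mollify k₁ f x) * mollify k₂ f x).im = 0 := by
  have : ENNReal.HolderConjugate 2 2 := inferInstance
  rw [integral_mollify_mul (p := 2) (p' := 2) hk₁ hk₂ hk₁c hk₂c hf hf hf2 hf2,
    ← Complex.conj_eq_iff_im, ← integral_conj, ← integral_neg_prod]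
  refine integral_congr_ae (ae_of_all _ fun z => ?_)
  simp only [Prod.fst_neg, Prod.snd_neg, hk₁e, hk₂e, correlation_neg, Complex.real_smul, map_mul,
    Complex.conj_ofReal, Complex.conj_conj]

/-! ### Approximate identities -/

theorem tendsto_eLpNorm_translate_sub {d : ℕ} {p : ℝ≥0∞} (hp1 : 1 ≤ p) (hp : p ≠ ⊤)
    {f : Space d → ℂ} (hf : MemLp f p) :
    Tendsto (fun a : Space d => eLpNorm (fun x => f (x - a) - f x) p) (𝓝 0) (𝓝 0) := by
  have : Fact (1 ≤ p) := ⟨hp1⟩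
  let g : Space d → C(Space d, Space d) := fun a => ⟨fun x => x - a, by fun_prop⟩
  have hg : Continuous g := by
    refine ContinuousMap.continuous_of_continuous_uncurry _ ?_
    change Continuous fun z : Space d × Space d => z.2 - z.1
    fun_prop
  have hgm (a : Space d) : MeasurePreserving (g a) := measurePreserving_sub_right volume a
  have h1 := (continuous_const (y := hf.toLp f)).compMeasurePreservingLp hg hgm hp
  have h2 : Tendsto (fun a => ‖Lp.compMeasurePreserving (g a) (hgm a) (hf.toLp f) - hf.toLp f‖ₑ)
      (𝓝 0) (𝓝 ‖Lp.compMeasurePreserving (g 0) (hgm 0) (hf.toLp f) - hf.toLp f‖ₑ) :=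
    (h1.sub (continuous_const (y := hf.toLp f))).enorm.tendsto 0
  have hval (a : Space d) :
      ‖Lp.compMeasurePreserving (g a) (hgm a) (hf.toLp f) - hf.toLp f‖ₑ
        = eLpNorm (fun x => f (x - a) - f x) p := by
    rw [Lp.enorm_def]
    refine eLpNorm_congr_ae ?_
    filter_upwards [Lp.coeFn_sub (Lp.compMeasurePreserving (g a) (hgm a) (hf.toLp f)) (hf.toLp f),
      Lp.coeFn_compMeasurePreserving (hf.toLp f) (hgm a), hf.coeFn_toLp,
      (hgm a).quasiMeasurePreserving.ae hf.coeFn_toLp] with x h1 h2 h3 h4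
    rw [h1, Pi.sub_apply, h2, h3, Function.comp_apply, h4]
    rfl
  have h3 : ‖Lp.compMeasurePreserving (g 0) (hgm 0) (hf.toLp f) - hf.toLp f‖ₑ = 0 := by
    rw [hval]
    simp
  rw [h3] at h2
  exact h2.congr hval

/-- Change one factor at a time and apply Hölder with continuity of translations in `L^p` and
`L^p'`. -/
theorem tendsto_correlation {d : ℕ} {p p' : ℝ≥0∞} [p.HolderConjugate p'] (hp : p ≠ ⊤)
    (hp' : p' ≠ ⊤) {f h : Space d → ℂ} (hf : MemLp f p) (hh : MemLp h p') :
    Tendsto (correlation f h) (𝓝 0) (𝓝 (correlation f h 0)) := by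
  rw [tendsto_iff_edist_tendsto_0]
  have h1 := tendsto_eLpNorm_translate_sub (ENNReal.HolderConjugate.one_le p p') hp hf
  have h2 := tendsto_eLpNorm_translate_sub (ENNReal.HolderConjugate.one_le p' p) hp' hh
  have h3 : Tendsto (fun z : Space d × Space d =>
      eLpNorm f p * eLpNorm (fun x => h (x - z.2) - h x) p'
        + eLpNorm (fun x => f (x - z.1) - f x) p * eLpNorm h p') (𝓝 0) (𝓝 0) := by
    have t1 : Tendsto (Prod.fst : Space d × Space d → Space d) (𝓝 0) (𝓝 0) :=
      continuous_fst.tendsto 0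
    have t2 : Tendsto (Prod.snd : Space d × Space d → Space d) (𝓝 0) (𝓝 0) :=
      continuous_snd.tendsto 0
    have hfin : eLpNorm f p ≠ ⊤ := hf.eLpNorm_ne_top
    have hhin : eLpNorm h p' ≠ ⊤ := hh.eLpNorm_ne_top
    have h1' := h1.comp t1
    have h2' := h2.comp t2
    simp only [Function.comp_def] at h1' h2'
    generalize eLpNorm f p = A at *
    generalize eLpNorm h p' = B at *
    have e1 := ENNReal.Tendsto.const_mul h2' (Or.inr hfin)
    have e2 := ENNReal.Tendsto.mul_const h1' (Or.inr hhin)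
    rw [mul_zero] at e1
    rw [zero_mul] at e2
    simpa only [add_zero] using e1.add e2
  refine tendsto_of_tendsto_of_tendsto_of_le_of_le tendsto_const_nhds h3 (fun _ => zero_le) ?_
  intro z
  have hfz := memLp_comp_sub hf z.1
  have hhz := memLp_comp_sub hh z.2
  have hfzc : MemLp (fun x => conj (f (x - z.1))) p := hfz.star
  have hfc : MemLp (fun x => conj (f x)) p := hf.star
  have i1 : Integrable fun x => conj (f (x - z.1)) * (h (x - z.2) - h x) :=
    hfzc.integrable_mul (hhz.sub hh)
  have i2 : Integrable fun x => conj (f (x - z.1) - f x) * h x :=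
    MemLp.integrable_mul (p := p) (q := p') (hfz.sub hf).star hh
  have i3 : Integrable fun x => conj (f (x - z.1)) * h (x - z.2) := hfzc.integrable_mul hhz
  have i4 : Integrable fun x => conj (f x) * h x := hfc.integrable_mul hh
  have hdiff : correlation f h z - correlation f h 0 =
      (∫ x, conj (f (x - z.1)) * (h (x - z.2) - h x)) + ∫ x, conj (f (x - z.1) - f x) * h x := by
    simp only [correlation, Prod.fst_zero, Prod.snd_zero, sub_zero]
    rw [← integral_sub i3 i4, ← integral_add i1 i2]
    refine integral_congr_ae (ae_of_all _ fun x => ?_)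
    simp only [map_sub]
    ring
  beta_reduce
  rw [edist_eq_enorm_sub, hdiff]
  refine (enorm_add_le _ _).trans (add_le_add ?_ ?_)
  · rw [← eLpNorm_comp_sub hf.1 z.1]
    refine le_trans (enorm_integral_le_lintegral_enorm _) (le_trans (lintegral_mono fun x => ?_)
      (lintegral_enorm_mul_le hfz.1 (hhz.sub hh).1))
    rw [enorm_mul, RCLike.enorm_conj]
  · refine le_trans (enorm_integral_le_lintegral_enorm _) (le_trans (lintegral_mono fun x => ?_)
      (lintegral_enorm_mul_le (hfz.sub hf).1 hh.1))
    rw [enorm_mul, RCLike.enorm_conj]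

/-- A standard mollifier of radius `(n + 1)⁻¹`. -/
def bump (d n : ℕ) : ContDiffBump (0 : Space d) where
  rIn := 1 / (2 * (n + 1))
  rOut := 1 / (n + 1)
  rIn_pos := by positivity
  rIn_lt_rOut := by
    have : (0 : ℝ) < n + 1 := by positivity
    rw [div_lt_div_iff₀ (by positivity) this]
    linarith

/-- The kernel of the standard mollifier. -/
def bumpKernel (d n : ℕ) : Space d → ℝ := (bump d n).normed volume

theorem contDiff_bumpKernel (d n : ℕ) : ContDiff ℝ (⊤ : ℕ∞) (bumpKernel d n) :=
  (bump d n).contDiff_normed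

theorem continuous_bumpKernel (d n : ℕ) : Continuous (bumpKernel d n) :=
  (contDiff_bumpKernel d n).continuous

theorem hasCompactSupport_bumpKernel (d n : ℕ) : HasCompactSupport (bumpKernel d n) :=
  ContDiffBump.hasCompactSupport_normed (μ := (volume : Measure (Space d))) (bump d n)

theorem bumpKernel_nonneg (d n : ℕ) (x : Space d) : 0 ≤ bumpKernel d n x :=
  (bump d n).nonneg_normed x

theorem bumpKernel_neg (d n : ℕ) (x : Space d) : bumpKernel d n (-x) = bumpKernel d n x :=
  (bump d n).normed_neg x

theorem integral_bumpKernel (d n : ℕ) : ∫ x, bumpKernel d n x = 1 := (bump d n).integral_normed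

theorem bumpKernel_eq_zero {d n : ℕ} {x : Space d} (hx : 1 / ((n : ℝ) + 1) ≤ ‖x‖) :
    bumpKernel d n x = 0 := by
  have h : x ∉ Function.support (bumpKernel d n) := by
    rw [bumpKernel, (bump d n).support_normed_eq, mem_ball_zero_iff, not_lt]
    exact hx
  exact Function.notMem_support.1 h

theorem lintegral_bumpKernel (d n : ℕ) : ∫⁻ x, ‖bumpKernel d n x‖ₑ = 1 := by
  have hi : Integrable (bumpKernel d n) :=
    (continuous_bumpKernel d n).integrable_of_hasCompactSupport (hasCompactSupport_bumpKernel d n)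
  have h := ofReal_integral_eq_lintegral_ofReal hi (ae_of_all _ (bumpKernel_nonneg d n))
  rw [integral_bumpKernel, ENNReal.ofReal_one] at h
  rw [h]
  exact lintegral_congr fun x => Real.enorm_eq_ofReal (bumpKernel_nonneg d n x)

/-- The pairing is the average of the correlation against a probability density shrinking to the
origin, where the correlation is continuous. It is used with both exponents `2` for the mass and
with the Strichartz pair for the nonlinearity. -/
theorem tendsto_integral_mollify_mul {d : ℕ} {p p' : ℝ≥0∞} [p.HolderConjugate p'] (hp : p ≠ ⊤)
    (hp' : p' ≠ ⊤) {f h : Space d → ℂ} (hf : StronglyMeasurable f) (hh : StronglyMeasurable h)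
    (hfp : MemLp f p) (hhp : MemLp h p') :
    Tendsto (fun n => ∫ x, conj (mollify (bumpKernel d n) f x) * mollify (bumpKernel d n) h x) atTop
      (𝓝 (∫ x, conj (f x) * h x)) := by
  have h0 : ∫ x, conj (f x) * h x = correlation f h 0 := by simp [correlation]
  rw [h0, Metric.tendsto_atTop]
  intro ε hε
  obtain ⟨r, hr, hball⟩ := Metric.tendsto_nhds_nhds.1 (tendsto_correlation hp hp' hfp hhp) (ε / 2)
    (half_pos hε)
  obtain ⟨N, hN⟩ := exists_nat_one_div_lt hr
  refine ⟨N, fun n hn => ?_⟩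
  set φ := bumpKernel d n
  have hφ := continuous_bumpKernel d n
  have hφc := hasCompactSupport_bumpKernel d n
  have hφi : Integrable φ := hφ.integrable_of_hasCompactSupport hφc
  have hφφ : Integrable fun z : Space d × Space d => φ z.1 * φ z.2 := hφi.mul_prod hφi
  have h1 : ∫ z : Space d × Space d, φ z.1 * φ z.2 = 1 := by
    have := integral_prod_mul (μ := (volume : Measure (Space d)))
      (ν := (volume : Measure (Space d))) φ φ
    rw [integral_bumpKernel, mul_one] at this
    exact this
  have h2 : correlation f h 0 = ∫ z : Space d × Space d, (φ z.1 * φ z.2) • correlation f h 0 := by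
    rw [integral_smul_const, h1, one_smul]
  rw [integral_mollify_mul hφ hφ hφc hφc hf hh hfp hhp, dist_eq_norm]
  conv_lhs => rw [h2]
  rw [← integral_sub (integrable_smul_correlation hφ hφ hφc hφc hf hh hfp hhp)
    (hφφ.smul_const _)]
  refine lt_of_le_of_lt (norm_integral_le_of_norm_le (hφφ.mul_const (ε / 2))
    (ae_of_all _ fun z => ?_)) (by rw [integral_mul_const, h1]; linarith)
  rw [← smul_sub, norm_smul, Real.norm_of_nonneg
    (mul_nonneg (bumpKernel_nonneg _ _ _) (bumpKernel_nonneg _ _ _))]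
  have hsmall : ∀ {x : Space d}, φ x ≠ 0 → ‖x‖ < r := fun {x} hx => by
    by_contra! hcon
    refine hx (bumpKernel_eq_zero (le_trans ?_ hcon))
    refine le_trans (one_div_le_one_div_of_le (by positivity) ?_) hN.le
    gcongr
  by_cases hz : φ z.1 = 0 ∨ φ z.2 = 0
  · have : φ z.1 * φ z.2 = 0 := mul_eq_zero.2 hz
    rw [this, zero_mul, zero_mul]
  · rw [not_or] at hz
    refine mul_le_mul_of_nonneg_left ?_
      (mul_nonneg (bumpKernel_nonneg _ _ _) (bumpKernel_nonneg _ _ _))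
    rw [← dist_eq_norm]
    refine (hball ?_).le
    rw [dist_zero_right, Prod.norm_def]
    exact max_lt (hsmall hz.1) (hsmall hz.2)

/-! ### The Laplacian of a translated even kernel -/

theorem two_le_smooth : (2 : WithTop ℕ∞) ≤ ((⊤ : ℕ∞) : WithTop ℕ∞) :=
  WithTop.coe_le_coe.2 (le_top : (2 : ℕ∞) ≤ ⊤)

theorem laplacian_comp_neg {d : ℕ} {f : Space d → ℝ} (hf : ContDiff ℝ (⊤ : ℕ∞) f) (x : Space d) :
    Δ (fun y => f (-y)) x = Δ f (-x) := by
  rw [InnerProductSpace.laplacian_eq_iteratedFDeriv_stdOrthonormalBasis,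
    InnerProductSpace.laplacian_eq_iteratedFDeriv_stdOrthonormalBasis]
  refine Finset.sum_congr rfl fun i _ => ?_
  have h := (-ContinuousLinearMap.id ℝ (Space d)).iteratedFDeriv_comp_right hf x (i := 2)
    two_le_smooth
  have h' : iteratedFDeriv ℝ 2 (fun y => f (-y)) x = iteratedFDeriv ℝ 2
      (f ∘ (-ContinuousLinearMap.id ℝ (Space d))) x := rfl
  rw [h', h]
  simp only [ContinuousMultilinearMap.compContinuousLinearMap_apply, neg_apply,
    ContinuousLinearMap.id_apply]
  have := (iteratedFDeriv ℝ 2 f (-x)).map_smul_univ (fun _ => (-1 : ℝ))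
    ![stdOrthonormalBasis ℝ (Space d) i, stdOrthonormalBasis ℝ (Space d) i]
  simpa [neg_one_smul] using this

theorem laplacian_neg_of_even {d : ℕ} {f : Space d → ℝ} (hf : ContDiff ℝ (⊤ : ℕ∞) f)
    (he : ∀ x, f (-x) = f x) (x : Space d) : Δ f (-x) = Δ f x := by
  rw [← laplacian_comp_neg hf]
  simp only [he]

/-- Evenness replaces `f (x - y)` by a plain translate in `y`, and the Laplacian of an even function
is even. -/
theorem laplacian_ofReal_translate {d : ℕ} {f : Space d → ℝ} (hf : ContDiff ℝ (⊤ : ℕ∞) f)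
    (he : ∀ x, f (-x) = f x) (x y : Space d) :
    Δ (fun y => (f (x - y) : ℂ)) y = (Δ f (x - y) : ℂ) := by
  have h1 : (fun y => (f (x - y) : ℂ)) = Complex.ofRealCLM ∘ fun y => f (y - x) := by
    ext y
    simp [← he (x - y)]
  have h2 : ContDiff ℝ (⊤ : ℕ∞) fun y => f (y - x) := hf.comp (contDiff_id.sub contDiff_const)
  rw [h1, ContDiffAt.laplacian_CLM_comp_left (h2.contDiffAt.of_le two_le_smooth),
    Function.comp_apply, Complex.ofRealCLM_apply, ← laplacian_neg_of_even hf he (x - y), neg_sub]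
  congr 1
  rw [InnerProductSpace.laplacian_eq_iteratedFDeriv_stdOrthonormalBasis,
    InnerProductSpace.laplacian_eq_iteratedFDeriv_stdOrthonormalBasis]
  simp only [iteratedFDeriv_comp_sub]

theorem continuous_laplacian {d : ℕ} {f : Space d → ℝ} (hf : ContDiff ℝ (⊤ : ℕ∞) f) :
    Continuous (Δ f) := by
  rw [InnerProductSpace.laplacian_eq_iteratedFDeriv_stdOrthonormalBasis]
  refine continuous_finsetSum _ fun i _ => ?_
  exact (ContinuousMultilinearMap.apply ℝ (fun _ : Fin 2 => Space d) ℝ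
    ![stdOrthonormalBasis ℝ (Space d) i, stdOrthonormalBasis ℝ (Space d) i]).continuous.comp
    (hf.continuous_iteratedFDeriv (m := 2) two_le_smooth)

theorem hasCompactSupport_laplacian {d : ℕ} {f : Space d → ℝ} (hf : HasCompactSupport f) :
    HasCompactSupport (Δ f) := by
  refine (hf.iteratedFDeriv (𝕜 := ℝ) 2).mono fun x hx => ?_
  contrapose! hx
  rw [Function.mem_support, not_not] at hx ⊢
  rw [InnerProductSpace.laplacian_eq_iteratedFDeriv_stdOrthonormalBasis]
  simp [hx]

/-! ### The squared modulus of an absolutely continuous function -/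

theorem sq_sub_sq_of_eq_integral {v g : ℝ → ℝ} {b : ℝ} (hb : 0 ≤ b)
    (hg : IntervalIntegrable g volume 0 b) (hv : ∀ t ∈ Icc 0 b, v t = v 0 + ∫ s in (0 : ℝ)..t, g s) :
    v b ^ 2 - v 0 ^ 2 = ∫ s in (0 : ℝ)..b, 2 * (v s * g s) := by
  -- `v` is controlled only on `[0, b]`; the primitive `w` is defined on the whole line and can be
  -- differentiated there.
  set w : ℝ → ℝ := fun t => v 0 + ∫ s in (0 : ℝ)..t, g s
  have hw0 : w 0 = v 0 := by simp [w]
  have hwb : w b = v b := (hv b (right_mem_Icc.2 hb)).symm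
  have hac : AbsolutelyContinuousOnInterval w 0 b :=
    (LipschitzOnWith.absolutelyContinuousOnInterval (K := 0)
      (LipschitzWith.const (v 0)).lipschitzOnWith).add
      (hg.absolutelyContinuousOnInterval_intervalIntegral left_mem_uIcc)
  have h1 := hac.integral_deriv_mul_eq_sub hac
  rw [hw0, hwb] at h1
  rw [pow_two, pow_two, ← h1]
  refine intervalIntegral.integral_congr_ae ?_
  filter_upwards [hg.ae_hasDerivAt_integral] with s hs hs'
  have hs'' := uIoc_subset_uIcc hs'
  have h2 : HasDerivAt w (g s) s := (hs hs'' 0 left_mem_uIcc).const_add (v 0)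
  rw [uIcc_of_le hb] at hs''
  rw [h2.deriv, ← show w s = v s from (hv s hs'').symm]
  ring

theorem norm_sq_sub_norm_sq_of_eq_integral {v g : ℝ → ℂ} {b : ℝ} (hb : 0 ≤ b)
    (hg : IntervalIntegrable g volume 0 b) (hv : ∀ t ∈ Icc 0 b, v t = v 0 + ∫ s in (0 : ℝ)..t, g s) :
    ‖v b‖ ^ 2 - ‖v 0‖ ^ 2 = ∫ s in (0 : ℝ)..b, 2 * (conj (v s) * g s).re := by
  have hre : IntervalIntegrable (fun s => (g s).re) volume 0 b :=
    ⟨hg.1.re, hg.2.re⟩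
  have him : IntervalIntegrable (fun s => (g s).im) volume 0 b :=
    ⟨hg.1.im, hg.2.im⟩
  have hsub (t) (ht : t ∈ Icc 0 b) : IntervalIntegrable g volume 0 t :=
    hg.mono_set (by rw [uIcc_of_le hb, uIcc_of_le ht.1]; exact Icc_subset_Icc_right ht.2)
  have hvc : ContinuousOn v (Icc 0 b) := by
    have h1 := intervalIntegral.continuousOn_primitive_interval (μ := volume)
      (by rw [uIcc_of_le hb]; exact (intervalIntegrable_iff_integrableOn_Icc_of_le hb).1 hg)
    rw [uIcc_of_le hb] at h1
    exact (continuousOn_const.add h1).congr hv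
  have e1 := sq_sub_sq_of_eq_integral (v := fun t => (v t).re) hb hre fun t ht => by
    rw [hv t ht, Complex.add_re]
    exact congrArg _ (Complex.reCLM.intervalIntegral_comp_comm (hsub t ht)).symm
  have e2 := sq_sub_sq_of_eq_integral (v := fun t => (v t).im) hb him fun t ht => by
    rw [hv t ht, Complex.add_im]
    exact congrArg _ (Complex.imCLM.intervalIntegral_comp_comm (hsub t ht)).symm
  have hvc' : ContinuousOn v (uIcc 0 b) := by rwa [uIcc_of_le hb]
  have i1 : IntervalIntegrable (fun s => 2 * ((v s).re * (g s).re)) volume 0 b :=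
    (hre.continuousOn_mul (Complex.continuous_re.comp_continuousOn hvc')).const_mul 2
  have i2 : IntervalIntegrable (fun s => 2 * ((v s).im * (g s).im)) volume 0 b :=
    (him.continuousOn_mul (Complex.continuous_im.comp_continuousOn hvc')).const_mul 2
  have h3 (s : ℝ) : 2 * (conj (v s) * g s).re
      = 2 * ((v s).re * (g s).re) + 2 * ((v s).im * (g s).im) := by
    simp only [Complex.mul_re, Complex.conj_re, Complex.conj_im]
    ring
  simp only [h3]
  rw [intervalIntegral.integral_add i1 i2, ← e1, ← e2]
  simp only [← Complex.normSq_eq_norm_sq, Complex.normSq_apply]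
  ring

/-! ### The nonlinearity -/

/-- The nonlinearity `|z|^{4/d} z`. -/
def nonlinearity (d : ℕ) (z : ℂ) : ℂ := ((‖z‖ ^ (4 / (d : ℝ)) : ℝ) : ℂ) * z

theorem continuous_nonlinearity (d : ℕ) : Continuous (nonlinearity d) :=
  (Complex.continuous_ofReal.comp
    (continuous_norm.rpow_const fun _ => Or.inr (by positivity))).mul continuous_id

theorem conj_mul_nonlinearity_im (d : ℕ) (z : ℂ) : (conj z * nonlinearity d z).im = 0 := by
  rw [nonlinearity, mul_left_comm, mul_comm (conj z), Complex.mul_conj, ← Complex.ofReal_mul,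
    Complex.ofReal_im]

/-- The exponent dual to the Strichartz exponent. -/
def dualExponent (d : ℕ) : ℝ := (strichartzExponent d).conjExponent

theorem holderConjugate_dualExponent {d : ℕ} (hd : 1 ≤ d) :
    (strichartzExponent d).HolderConjugate (dualExponent d) :=
  Real.HolderConjugate.conjExponent (by linarith [two_lt_strichartzExponent hd])

/-- The modulus of the nonlinearity is `‖z‖ ^ (q - 1)`, and `(q - 1) q' = q`. Hence it lies in the
dual space exactly when the function lies in `L^q`. -/
theorem enorm_nonlinearity_rpow {d : ℕ} (hd : 1 ≤ d) (z : ℂ) :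
    ‖nonlinearity d z‖ₑ ^ dualExponent d = ‖z‖ₑ ^ strichartzExponent d := by
  have h := holderConjugate_dualExponent hd
  have hd0 : (0 : ℝ) < 4 / d := by positivity
  have h1 : ‖nonlinearity d z‖ = ‖z‖ ^ (strichartzExponent d - 1) := by
    rw [nonlinearity, norm_mul, Complex.norm_real, Real.norm_of_nonneg (by positivity),
      strichartzExponent_eq hd, show (2 : ℝ) + 4 / d - 1 = 4 / d + 1 by ring,
      Real.rpow_add_one' (norm_nonneg _) (by positivity)]
  rw [← ofReal_norm, ← ofReal_norm, h1, ENNReal.ofReal_rpow_of_nonneg (by positivity) h.symm.nonneg,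
    ENNReal.ofReal_rpow_of_nonneg (norm_nonneg _) h.nonneg, ← Real.rpow_mul (norm_nonneg _),
    h.sub_one_mul_conj]

theorem eLpNorm_strichartz {d : ℕ} (hd : 1 ≤ d) (g : L2 d) :
    eLpNorm g (ENNReal.ofReal (strichartzExponent d)) volume
      = spacePow g ^ (1 / strichartzExponent d) := by
  have hq := strichartzExponent_pos hd
  rw [eLpNorm_eq_lintegral_rpow_enorm_toReal (ENNReal.ofReal_pos.2 hq).ne' ENNReal.ofReal_ne_top,
    ENNReal.toReal_ofReal hq.le]
  rfl

theorem eLpNorm_nonlinearity {d : ℕ} (hd : 1 ≤ d) (g : L2 d) :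
    eLpNorm (fun y => nonlinearity d (g y)) (ENNReal.ofReal (dualExponent d)) volume
      = spacePow g ^ (1 / dualExponent d) := by
  have hq := (holderConjugate_dualExponent hd).symm.pos
  rw [eLpNorm_eq_lintegral_rpow_enorm_toReal (ENNReal.ofReal_pos.2 hq).ne' ENNReal.ofReal_ne_top,
    ENNReal.toReal_ofReal hq.le]
  simp only [enorm_nonlinearity_rpow hd]
  rfl

theorem eLpNorm_mul_eLpNorm_nonlinearity {d : ℕ} (hd : 1 ≤ d) (g : L2 d) :
    eLpNorm g (ENNReal.ofReal (strichartzExponent d)) volume *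
      eLpNorm (fun y => nonlinearity d (g y)) (ENNReal.ofReal (dualExponent d)) volume
        = spacePow g := by
  have h := holderConjugate_dualExponent hd
  rw [eLpNorm_strichartz hd, eLpNorm_nonlinearity hd, ← ENNReal.rpow_add_of_nonneg _ _
    (one_div_nonneg.2 h.nonneg) (one_div_nonneg.2 h.symm.nonneg), one_div, one_div,
    h.inv_add_inv_eq_one, ENNReal.rpow_one]

theorem stronglyMeasurable_nonlinearity {d : ℕ} (g : L2 d) :
    StronglyMeasurable fun y => nonlinearity d (g y) :=
  (continuous_nonlinearity d).comp_stronglyMeasurable (Lp.stronglyMeasurable g)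

theorem memLp_strichartz {d : ℕ} (hd : 1 ≤ d) {g : L2 d} (hg : spacePow g < ⊤) :
    MemLp g (ENNReal.ofReal (strichartzExponent d)) volume := by
  refine ⟨Lp.aestronglyMeasurable g, ?_⟩
  rw [eLpNorm_strichartz hd]
  exact ENNReal.rpow_lt_top_of_nonneg (one_div_nonneg.2 (strichartzExponent_pos hd).le) hg.ne

theorem memLp_nonlinearity {d : ℕ} (hd : 1 ≤ d) {g : L2 d} (hg : spacePow g < ⊤) :
    MemLp (fun y => nonlinearity d (g y)) (ENNReal.ofReal (dualExponent d)) volume := by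
  refine ⟨(stronglyMeasurable_nonlinearity g).aestronglyMeasurable, ?_⟩
  rw [eLpNorm_nonlinearity hd]
  exact ENNReal.rpow_lt_top_of_nonneg
    (one_div_nonneg.2 (holderConjugate_dualExponent hd).symm.nonneg) hg.ne

theorem one_le_ofReal_dualExponent {d : ℕ} (hd : 1 ≤ d) : 1 ≤ ENNReal.ofReal (dualExponent d) := by
  rw [← ENNReal.ofReal_one]
  exact ENNReal.ofReal_le_ofReal (holderConjugate_dualExponent hd).symm.lt.le

/-! ### Mollified curves in `L²`: regularity in time and space -/

section Curve

variable {d : ℕ} {U : ℝ → L2 d} {k : Space d → ℝ}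

theorem memLp_translate (hk : Continuous k) (hkc : HasCompactSupport k) (p : ℝ≥0∞) (x : Space d) :
    MemLp (fun y => (k (x - y) : ℂ)) p volume := by
  refine Continuous.memLp_of_hasCompactSupport ?_ ?_
  · exact Complex.continuous_ofReal.comp (hk.comp (by fun_prop))
  · exact (hkc.comp_homeomorph (Homeomorph.subLeft x)).comp_left (g := ((↑) : ℝ → ℂ)) rfl

theorem continuous_mollify_curve (hU : Continuous U) (hk : Continuous k)
    (hkc : HasCompactSupport k) (x : Space d) : Continuous fun s => mollify k (U s) x := by
  have hm := memLp_translate hk hkc 2 x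
  have h1 (s : ℝ) : mollify k (U s) x = inner ℂ (hm.toLp _) (U s) := by
    rw [L2.inner_def, mollify]
    refine integral_congr_ae ?_
    filter_upwards [hm.coeFn_toLp] with y hy
    rw [hy, RCLike.inner_apply, Complex.conj_ofReal]
  simp only [h1]
  exact continuous_const.inner hU

/-- A Carathéodory argument: mollification is continuous in `x` and continuous in time. This gives
the joint measurability that the unmollified representatives need not have. -/
theorem stronglyMeasurable_mollify_curve (hU : Continuous U) (hk : Continuous k)
    (hkc : HasCompactSupport k) :
    StronglyMeasurable fun z : ℝ × Space d => mollify k (U z.1) z.2 := by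
  have h := stronglyMeasurable_uncurry_of_continuous_of_stronglyMeasurable
    (u := fun (x : Space d) (s : ℝ) => mollify k (U s) x)
    (fun s => continuous_mollify hk hkc ((Lp.memLp (U s)).locallyIntegrable one_le_two))
    (fun x => (continuous_mollify_curve hU hk hkc x).stronglyMeasurable)
  exact h.comp_measurable measurable_swap

/-- The times at which `U` belongs to `L^q`. -/
def goodTimes (U : ℝ → L2 d) : Set ℝ := {s | spacePow (U s) < ⊤}

theorem measurable_spacePow_curve (hU : Continuous U) : Measurable fun s => spacePow (U s) :=
  LowerSemicontinuous.measurable (lowerSemicontinuous_spacePow.comp hU)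

theorem measurableSet_goodTimes (hU : Continuous U) : MeasurableSet (goodTimes U) :=
  measurableSet_lt (measurable_spacePow_curve hU) measurable_const

/-- The mollified nonlinearity, set to zero at the times at which `U` is not in `L^q`. -/
def mollifiedNonlinearity (k : Space d → ℝ) (U : ℝ → L2 d) (s : ℝ) (x : Space d) : ℂ :=
  (goodTimes U).indicator (fun s => mollify k (fun y => nonlinearity d (U s y)) x) s

theorem integrable_nonlinearity_mul (hd : 1 ≤ d) (hk : Continuous k) (hkc : HasCompactSupport k)
    {g : L2 d} (hg : spacePow g < ⊤) (x : Space d) :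
    Integrable fun y => nonlinearity d (g y) * (k (x - y) : ℂ) := by
  have : ENNReal.HolderConjugate (ENNReal.ofReal (dualExponent d))
      (ENNReal.ofReal (strichartzExponent d)) :=
    (holderConjugate_dualExponent hd).symm.ennrealOfReal
  exact (memLp_nonlinearity hd hg).integrable_mul
    (memLp_translate hk hkc (ENNReal.ofReal (strichartzExponent d)) x)

/-- The nonlinearity is not continuous along an `L²` curve, but the positive and negative parts of
the real and imaginary integrands have integrals that are lower semicontinuous on `L²`, hence
measurable in time. At good times the integral is recovered from these four pieces. -/
theorem stronglyMeasurable_mollifiedNonlinearity_time (hd : 1 ≤ d) (hU : Continuous U)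
    (hk : Continuous k) (hkc : HasCompactSupport k) (x : Space d) :
    StronglyMeasurable fun s => mollifiedNonlinearity k U s x := by
  have hcont (y : Space d) : Continuous fun z => nonlinearity d z * (k (x - y) : ℂ) :=
    (continuous_nonlinearity d).mul continuous_const
  have hcont' : Continuous fun w : Space d × ℂ => nonlinearity d w.2 * (k (x - w.1) : ℂ) :=
    ((continuous_nonlinearity d).comp continuous_snd).mul
      (Complex.continuous_ofReal.comp (hk.comp (by fun_prop)))
  have key (r : ℂ → ℝ) (hr : Continuous r) : Measurable fun s =>
      (∫⁻ y, ENNReal.ofReal (r (nonlinearity d (U s y) * (k (x - y) : ℂ)))).toReal := by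
    have h1 := lowerSemicontinuous_lintegral_comp
      (θ := fun y z => ENNReal.ofReal (r (nonlinearity d z * (k (x - y) : ℂ))))
      (fun y => ENNReal.continuous_ofReal.comp (hr.comp (hcont y)))
      (ENNReal.continuous_ofReal.comp (hr.comp hcont')).measurable
    exact (LowerSemicontinuous.measurable (LowerSemicontinuous.comp h1 hU)).ennreal_toReal
  have hre := key Complex.re Complex.continuous_re
  have hre' := key (fun z => -z.re) Complex.continuous_re.neg
  have him := key Complex.im Complex.continuous_im
  have him' := key (fun z => -z.im) Complex.continuous_im.neg
  have hform := (((Complex.measurable_ofReal.comp (hre.sub hre')).add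
    ((Complex.measurable_ofReal.comp (him.sub him')).mul_const Complex.I)).indicator
      (measurableSet_goodTimes hU)).stronglyMeasurable
  convert hform using 1
  ext s
  by_cases hs : s ∈ goodTimes U
  · rw [mollifiedNonlinearity, indicator_of_mem hs, indicator_of_mem hs, mollify]
    have hi := integrable_nonlinearity_mul hd hk hkc hs x
    rw [← integral_re_add_im hi]
    have e1 := integral_eq_lintegral_pos_part_sub_lintegral_neg_part hi.re
    have e2 := integral_eq_lintegral_pos_part_sub_lintegral_neg_part hi.im
    rw [e1, e2]
    rfl
  · rw [mollifiedNonlinearity, indicator_of_notMem hs, indicator_of_notMem hs]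

theorem stronglyMeasurable_mollifiedNonlinearity (hd : 1 ≤ d) (hU : Continuous U)
    (hk : Continuous k) (hkc : HasCompactSupport k) :
    StronglyMeasurable fun z : ℝ × Space d => mollifiedNonlinearity k U z.1 z.2 := by
  have h := stronglyMeasurable_uncurry_of_continuous_of_stronglyMeasurable
    (u := fun (x : Space d) (s : ℝ) => mollifiedNonlinearity k U s x) (fun s => ?_)
    (fun x => stronglyMeasurable_mollifiedNonlinearity_time hd hU hk hkc x)
  · exact h.comp_measurable measurable_swap
  -- Setting the function to zero at bad times gives continuity in `x` at every time, as the
  -- Carathéodory argument requires.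
  · by_cases hs : s ∈ goodTimes U
    · simp only [mollifiedNonlinearity, indicator_of_mem hs]
      exact continuous_mollify hk hkc
        ((memLp_nonlinearity hd hs).locallyIntegrable (one_le_ofReal_dualExponent hd))
    · simp only [mollifiedNonlinearity, indicator_of_notMem hs]
      exact continuous_const

/-- Hölder gives the power `1 / q' ≤ 1` of `spacePow`, which is at most `1 + spacePow`, a function
integrable over a bounded time interval. -/
theorem enorm_mollifiedNonlinearity_le (hd : 1 ≤ d) (hk : Continuous k) (hkc : HasCompactSupport k)
    (s : ℝ) (x : Space d) :
    ‖mollifiedNonlinearity k U s x‖ₑ ≤ (1 + spacePow (U s)) *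
      eLpNorm (fun y => (k (x - y) : ℂ)) (ENNReal.ofReal (strichartzExponent d)) volume := by
  by_cases hs : s ∈ goodTimes U
  · have hqq := holderConjugate_dualExponent hd
    have : ENNReal.HolderConjugate (ENNReal.ofReal (dualExponent d))
        (ENNReal.ofReal (strichartzExponent d)) := hqq.symm.ennrealOfReal
    rw [mollifiedNonlinearity, indicator_of_mem hs, mollify]
    refine (enorm_integral_le_lintegral_enorm _).trans ?_
    simp only [enorm_mul]
    refine (lintegral_enorm_mul_le (p := ENNReal.ofReal (dualExponent d))
      (p' := ENNReal.ofReal (strichartzExponent d)) (memLp_nonlinearity hd hs).1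
      (memLp_translate hk hkc (ENNReal.ofReal (strichartzExponent d)) x).1).trans ?_
    refine mul_le_mul' ?_ le_rfl
    rw [eLpNorm_nonlinearity hd]
    have hle : 1 / dualExponent d ≤ 1 := by
      rw [div_le_one hqq.symm.pos]
      exact hqq.symm.lt.le
    rcases le_total (spacePow (U s)) 1 with h1 | h1
    · exact (ENNReal.rpow_le_one h1 (one_div_nonneg.2 hqq.symm.nonneg)).trans le_self_add
    · refine le_trans ?_ le_add_self
      calc spacePow (U s) ^ (1 / dualExponent d) ≤ spacePow (U s) ^ (1 : ℝ) :=
            ENNReal.rpow_le_rpow_of_exponent_le h1 hle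
        _ = _ := ENNReal.rpow_one _
  · simp [mollifiedNonlinearity, indicator_of_notMem hs]

end Curve

/-! ### Conservation of mass -/

section Mass

variable {d : ℕ} {μ : ℝ} {u : ℝ → L2 d} {T b : ℝ}

/-- The curve `u`, frozen outside `[0, b]`. -/
def clampCurve (u : ℝ → L2 d) (hb : 0 ≤ b) (s : ℝ) : L2 d := u (projIcc 0 b hb s)

theorem clampCurve_eq (u : ℝ → L2 d) (hb : 0 ≤ b) {s : ℝ} (hs : s ∈ Icc 0 b) :
    clampCurve u hb s = u s := by
  rw [clampCurve, projIcc_of_mem hb hs]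

theorem IsSolution.continuous_clampCurve (h : IsSolution μ u T) (hb : b ∈ Ico 0 T) :
    Continuous (clampCurve u hb.1) :=
  (continuousOn_iff_continuous_domRestrict.1
    (h.continuousOn.mono (Icc_subset_Ico_right hb.2))).comp continuous_projIcc

theorem IsSolution.lintegral_clampCurve_lt_top (hd : 1 ≤ d) (h : IsSolution μ u T)
    (hb : b ∈ Ico 0 T) : ∫⁻ s in Ioc 0 b, spacePow (clampCurve u hb.1 s) < ⊤ := by
  refine lt_of_le_of_lt ?_ (h.strichartzPow_lt_top hd hb)
  rw [strichartzPow_eq, setLIntegral_congr_fun measurableSet_Ioc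
    (g := fun s => spacePow (u s)) fun s hs => by
      simp only [clampCurve_eq u hb.1 (Ioc_subset_Icc_self hs)]]
  exact lintegral_mono_set Ioc_subset_Icc_self

theorem IsSolution.ae_mem_goodTimes (hd : 1 ≤ d) (h : IsSolution μ u T) (hb : b ∈ Ico 0 T) :
    ∀ᵐ s ∂volume.restrict (Ioc 0 b), s ∈ goodTimes (clampCurve u hb.1) :=
  ae_lt_top (measurable_spacePow_curve (h.continuous_clampCurve hb))
    (h.lintegral_clampCurve_lt_top hd hb).ne

theorem IsSolution.intervalIntegrable_mollifiedNonlinearity (hd : 1 ≤ d) (h : IsSolution μ u T)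
    (hb : b ∈ Ico 0 T) {k : Space d → ℝ} (hk : Continuous k) (hkc : HasCompactSupport k)
    (x : Space d) :
    IntervalIntegrable (fun s => mollifiedNonlinearity k (clampCurve u hb.1) s x) volume 0 b := by
  have hU := h.continuous_clampCurve hb
  rw [intervalIntegrable_iff_integrableOn_Ioc_of_le hb.1]
  refine ⟨(stronglyMeasurable_mollifiedNonlinearity_time hd hU hk hkc x).aestronglyMeasurable, ?_⟩
  rw [hasFiniteIntegral_iff_enorm]
  refine (lintegral_mono fun s => enorm_mollifiedNonlinearity_le hd hk hkc s x).trans_lt ?_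
  rw [lintegral_mul_const _ ((measurable_spacePow_curve hU).const_add _),
    lintegral_add_left measurable_const]
  refine ENNReal.mul_lt_top (ENNReal.add_lt_top.2 ⟨?_, h.lintegral_clampCurve_lt_top hd hb⟩)
    (memLp_translate hk hkc _ x).2
  rw [setLIntegral_const, one_mul]
  exact measure_Ioc_lt_top

/-- The time derivative of the mollified solution. -/
def mollifiedRhs (μ : ℝ) (k : Space d → ℝ) (U : ℝ → L2 d) (s : ℝ) (x : Space d) : ℂ :=
  Complex.I * mollify (Δ k) (U s) x - Complex.I * μ * mollifiedNonlinearity k U s x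

/-- The weak equation tested with `y ↦ k (x - y)`. The bad times form a null set, so truncating the
nonlinearity there does not change the integral. -/
theorem IsSolution.mollify_eq_integral (hd : 1 ≤ d) (h : IsSolution μ u T) (hb : b ∈ Ico 0 T)
    {k : Space d → ℝ} (hk : ContDiff ℝ (⊤ : ℕ∞) k) (hkc : HasCompactSupport k)
    (hke : ∀ x, k (-x) = k x) (x : Space d) :
    IntervalIntegrable (fun s => mollifiedRhs μ k (clampCurve u hb.1) s x) volume 0 b ∧
      ∀ t ∈ Icc 0 b, mollify k (clampCurve u hb.1 t) x = mollify k (clampCurve u hb.1 0) x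
        + ∫ s in (0 : ℝ)..t, mollifiedRhs μ k (clampCurve u hb.1) s x := by
  have hU := h.continuous_clampCurve hb
  have hΔ := continuous_mollify_curve hU (continuous_laplacian hk) (hasCompactSupport_laplacian hkc) x
  have hN := h.intervalIntegrable_mollifiedNonlinearity hd hb hk.continuous hkc x
  refine ⟨((hΔ.intervalIntegrable 0 b).const_mul _).sub (hN.const_mul _), fun t ht => ?_⟩
  have hcc : HasCompactSupport fun y => (k (x - y) : ℂ) :=
    (hkc.comp_homeomorph (Homeomorph.subLeft x)).comp_left (g := ((↑) : ℝ → ℂ)) rfl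
  have hsm : ContDiff ℝ (⊤ : ℕ∞) fun y => (k (x - y) : ℂ) :=
    Complex.ofRealCLM.contDiff.comp (hk.comp (contDiff_const.sub contDiff_id))
  have heq := h.equation _ hsm hcc t ⟨ht.1, ht.2.trans_lt hb.2⟩
  have e1 : ∫ s in (0 : ℝ)..t, ∫ y, u s y * Δ (fun y => (k (x - y) : ℂ)) y
      = ∫ s in (0 : ℝ)..t, mollify (Δ k) (clampCurve u hb.1 s) x := by
    refine intervalIntegral.integral_congr fun s hs => ?_
    rw [uIcc_of_le ht.1] at hs
    simp only [laplacian_ofReal_translate hk hke, mollify,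
      clampCurve_eq u hb.1 (Icc_subset_Icc_right ht.2 hs)]
  have e2 : ∫ s in (0 : ℝ)..t, ∫ y, ((‖u s y‖ ^ (4 / (d : ℝ)) : ℝ) : ℂ) * u s y * (k (x - y) : ℂ)
      = ∫ s in (0 : ℝ)..t, mollifiedNonlinearity k (clampCurve u hb.1) s x := by
    refine intervalIntegral.integral_congr_ae ?_
    filter_upwards [(ae_restrict_iff' measurableSet_Ioc).1 (h.ae_mem_goodTimes hd hb)] with s hs hs'
    rw [uIoc_of_le ht.1] at hs'
    have hs'' : s ∈ Ioc 0 b := Ioc_subset_Ioc_right ht.2 hs'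
    rw [mollifiedNonlinearity, indicator_of_mem (hs hs''),
      clampCurve_eq u hb.1 (Ioc_subset_Icc_self hs'')]
    rfl
  have hsub : uIcc 0 t ⊆ uIcc 0 b := by
    rw [uIcc_of_le ht.1, uIcc_of_le hb.1]
    exact Icc_subset_Icc_right ht.2
  rw [e1, e2] at heq
  unfold mollifiedRhs
  rw [intervalIntegral.integral_sub ((hΔ.intervalIntegrable 0 t).const_mul _)
    ((hN.mono_set hsub).const_mul _), intervalIntegral.integral_const_mul,
    intervalIntegral.integral_const_mul, clampCurve_eq u hb.1 ht,
    clampCurve_eq u hb.1 (left_mem_Icc.2 hb.1), ← add_sub_assoc]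
  exact heq

/-! ### Space-time integrability and limits of the mollified quantities. -/

theorem eLpNorm_two_eq (g : L2 d) : eLpNorm g 2 volume = ENNReal.ofReal ‖g‖ := by
  rw [Lp.norm_def, ENNReal.ofReal_toReal (Lp.eLpNorm_ne_top g)]

variable {k₁ k₂ : Space d → ℝ}

theorem integrable_linear_product {U : ℝ → L2 d} (hU : Continuous U) (hk₁ : Continuous k₁)
    (hk₁c : HasCompactSupport k₁) (hk₂ : Continuous k₂) (hk₂c : HasCompactSupport k₂) (b : ℝ) :
    Integrable (fun z : ℝ × Space d => conj (mollify k₁ (U z.1) z.2) * mollify k₂ (U z.1) z.2)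
      ((volume.restrict (Ioc 0 b)).prod volume) := by
  have : ENNReal.HolderConjugate 2 2 := inferInstance
  have hm : StronglyMeasurable fun z : ℝ × Space d =>
      conj (mollify k₁ (U z.1) z.2) * mollify k₂ (U z.1) z.2 :=
    (Complex.continuous_conj.comp_stronglyMeasurable
    (stronglyMeasurable_mollify_curve hU hk₁ hk₁c)).mul
    (stronglyMeasurable_mollify_curve hU hk₂ hk₂c)
  refine ⟨hm.aestronglyMeasurable, ?_⟩
  rw [hasFiniteIntegral_iff_enorm, lintegral_prod _ hm.measurable.enorm.aemeasurable]
  refine (lintegral_mono fun s => lintegral_mollify_mul_le (p := 2) (p' := 2) hk₁ hk₂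
    (Lp.stronglyMeasurable (U s)) (Lp.stronglyMeasurable (U s))).trans_lt ?_
  have hfin : (∫⁻ a, ‖k₁ a‖ₑ) * (∫⁻ a, ‖k₂ a‖ₑ) < ⊤ := ENNReal.mul_lt_top
    (lintegral_enorm_lt_top hk₁ hk₁c) (lintegral_enorm_lt_top hk₂ hk₂c)
  rw [lintegral_const_mul' _ _ hfin.ne]
  refine ENNReal.mul_lt_top hfin ?_
  simp only [eLpNorm_two_eq, ← ENNReal.ofReal_mul (norm_nonneg _)]
  have hc : Continuous fun s => ‖U s‖ * ‖U s‖ := hU.norm.mul hU.norm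
  exact ((hc.integrableOn_Icc (a := 0) (b := b)).mono_set Ioc_subset_Icc_self).lintegral_lt_top

/-- The kernels have mass one, so the bound does not depend on `n` and later serves as the
dominating function. -/
theorem lintegral_mollify_mul_nonlinearity_le (hd : 1 ≤ d) {U : ℝ → L2 d} (n : ℕ) (s : ℝ) :
    ∫⁻ x, ‖conj (mollify (bumpKernel d n) (U s) x) *
      mollifiedNonlinearity (bumpKernel d n) U s x‖ₑ ≤ spacePow (U s) := by
  by_cases hs : s ∈ goodTimes U
  · have : ENNReal.HolderConjugate (ENNReal.ofReal (strichartzExponent d))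
      (ENNReal.ofReal (dualExponent d)) := (holderConjugate_dualExponent hd).ennrealOfReal
    simp only [mollifiedNonlinearity, indicator_of_mem hs]
    refine (lintegral_mollify_mul_le (p := ENNReal.ofReal (strichartzExponent d))
      (p' := ENNReal.ofReal (dualExponent d)) (continuous_bumpKernel d n)
      (continuous_bumpKernel d n) (Lp.stronglyMeasurable (U s))
      (stronglyMeasurable_nonlinearity (U s))).trans_eq ?_
    rw [lintegral_bumpKernel, one_mul, one_mul, eLpNorm_mul_eLpNorm_nonlinearity hd]
  · simp [mollifiedNonlinearity, indicator_of_notMem hs]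

theorem IsSolution.integrable_nonlinear_product (hd : 1 ≤ d) (h : IsSolution μ u T)
    (hb : b ∈ Ico 0 T) (n : ℕ) :
    Integrable (fun z : ℝ × Space d => conj (mollify (bumpKernel d n) (clampCurve u hb.1 z.1) z.2) *
      mollifiedNonlinearity (bumpKernel d n) (clampCurve u hb.1) z.1 z.2)
      ((volume.restrict (Ioc 0 b)).prod volume) := by
  have hU := h.continuous_clampCurve hb
  have hm : StronglyMeasurable fun z : ℝ × Space d =>
      conj (mollify (bumpKernel d n) (clampCurve u hb.1 z.1) z.2) *
        mollifiedNonlinearity (bumpKernel d n) (clampCurve u hb.1) z.1 z.2 :=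
    (Complex.continuous_conj.comp_stronglyMeasurable
    (stronglyMeasurable_mollify_curve hU (continuous_bumpKernel d n)
      (hasCompactSupport_bumpKernel d n))).mul
    (stronglyMeasurable_mollifiedNonlinearity hd hU (continuous_bumpKernel d n)
      (hasCompactSupport_bumpKernel d n))
  refine ⟨hm.aestronglyMeasurable, ?_⟩
  rw [hasFiniteIntegral_iff_enorm, lintegral_prod _ hm.measurable.enorm.aemeasurable]
  exact (lintegral_mono fun s => lintegral_mollify_mul_nonlinearity_le hd n s).trans_lt
    (h.lintegral_clampCurve_lt_top hd hb)

/-- The pairing of the mollified solution with the mollified nonlinearity. -/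
def nonlinearPairing (n : ℕ) (U : ℝ → L2 d) (s : ℝ) : ℂ :=
  ∫ x, conj (mollify (bumpKernel d n) (U s) x) * mollifiedNonlinearity (bumpKernel d n) U s x

theorem enorm_nonlinearPairing_le (hd : 1 ≤ d) {U : ℝ → L2 d} (n : ℕ) (s : ℝ) :
    ‖nonlinearPairing n U s‖ₑ ≤ spacePow (U s) :=
  (enorm_integral_le_lintegral_enorm _).trans (lintegral_mollify_mul_nonlinearity_le hd n s)

theorem integrable_mollify_mul_nonlinearity (hd : 1 ≤ d) {U : ℝ → L2 d} (n : ℕ) {s : ℝ}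
    (hs : s ∈ goodTimes U) :
    Integrable fun x => conj (mollify (bumpKernel d n) (U s) x) *
      mollifiedNonlinearity (bumpKernel d n) U s x := by
  have : ENNReal.HolderConjugate (ENNReal.ofReal (strichartzExponent d))
    (ENNReal.ofReal (dualExponent d)) := (holderConjugate_dualExponent hd).ennrealOfReal
  simp only [mollifiedNonlinearity, indicator_of_mem hs]
  exact integrable_mollify_mul (p := ENNReal.ofReal (strichartzExponent d))
      (p' := ENNReal.ofReal (dualExponent d)) (continuous_bumpKernel d n)
      (continuous_bumpKernel d n) (hasCompactSupport_bumpKernel d n)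
      (hasCompactSupport_bumpKernel d n) (Lp.stronglyMeasurable (U s))
      (stronglyMeasurable_nonlinearity (U s)) (memLp_strichartz hd hs) (memLp_nonlinearity hd hs)

/-- The limit pairing has the real integrand `|u|^q`: this is the gauge invariance of the
nonlinearity. -/
theorem tendsto_nonlinearPairing (hd : 1 ≤ d) {U : ℝ → L2 d} {s : ℝ} (hs : s ∈ goodTimes U) :
    Tendsto (fun n => (nonlinearPairing n U s).im) atTop (𝓝 0) := by
  have : ENNReal.HolderConjugate (ENNReal.ofReal (strichartzExponent d))
    (ENNReal.ofReal (dualExponent d)) := (holderConjugate_dualExponent hd).ennrealOfReal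
  have h1 := tendsto_integral_mollify_mul (p := ENNReal.ofReal (strichartzExponent d))
      (p' := ENNReal.ofReal (dualExponent d)) ENNReal.ofReal_ne_top ENNReal.ofReal_ne_top
      (Lp.stronglyMeasurable (U s)) (stronglyMeasurable_nonlinearity (U s))
      (memLp_strichartz hd hs) (memLp_nonlinearity hd hs)
  have h2 : (∫ x, conj (U s x) * nonlinearity d (U s x)).im = 0 := by
    have hi : Integrable fun x => conj (U s x) * nonlinearity d (U s x) :=
      MemLp.integrable_mul (p := ENNReal.ofReal (strichartzExponent d))
        (q := ENNReal.ofReal (dualExponent d)) (memLp_strichartz hd hs).star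
        (memLp_nonlinearity hd hs)
    have h3 : (∫ x, (conj (U s x) * nonlinearity d (U s x)).im)
      = (∫ x, conj (U s x) * nonlinearity d (U s x)).im := integral_im hi
    rw [← h3]
    simp only [conj_mul_nonlinearity_im, integral_zero]
  have h3 := (Complex.continuous_im.tendsto _).comp h1
  rw [h2] at h3
  refine h3.congr fun n => ?_
  simp only [nonlinearPairing, mollifiedNonlinearity, indicator_of_mem hs]
  rfl

theorem conj_mul_self_eq (z : ℂ) : (conj z * z).re = ‖z‖ ^ 2 := by
  rw [mul_comm, Complex.mul_conj, Complex.normSq_eq_norm_sq, Complex.ofReal_re]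

theorem integrable_norm_mollify_sq (n : ℕ) (g : L2 d) :
    Integrable fun x => ‖mollify (bumpKernel d n) g x‖ ^ 2 := by
  have : ENNReal.HolderConjugate 2 2 := inferInstance
  have := (integrable_mollify_mul (p := 2) (p' := 2) (continuous_bumpKernel d n)
    (continuous_bumpKernel d n) (hasCompactSupport_bumpKernel d n)
    (hasCompactSupport_bumpKernel d n) (Lp.stronglyMeasurable g) (Lp.stronglyMeasurable g)
    (Lp.memLp g) (Lp.memLp g)).re
  refine this.congr (ae_of_all _ fun x => ?_)
  exact conj_mul_self_eq _

theorem tendsto_integral_norm_mollify_sq (g : L2 d) :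
    Tendsto (fun n => ∫ x, ‖mollify (bumpKernel d n) g x‖ ^ 2) atTop (𝓝 (‖g‖ ^ 2)) := by
  have : ENNReal.HolderConjugate 2 2 := inferInstance
  have h1 := (Complex.continuous_re.tendsto _).comp
    (tendsto_integral_mollify_mul (p := 2) (p' := 2) ENNReal.ofNat_ne_top ENNReal.ofNat_ne_top
      (Lp.stronglyMeasurable g) (Lp.stronglyMeasurable g) (Lp.memLp g) (Lp.memLp g))
  have h2 : (∫ x, conj (g x) * g x).re = ‖g‖ ^ 2 := by
    have h3 : inner ℂ g g = ∫ x, conj (g x) * g x := by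
      rw [L2.inner_def]
      refine integral_congr_ae (ae_of_all _ fun x => ?_)
      exact (RCLike.inner_apply _ _).trans (mul_comm _ _)
    rw [← h3, inner_self_eq_norm_sq_to_K]
    norm_cast
  rw [h2] at h1
  refine h1.congr fun n => ?_
  have hi := integrable_mollify_mul (p := 2) (p' := 2) (continuous_bumpKernel d n)
    (continuous_bumpKernel d n) (hasCompactSupport_bumpKernel d n)
    (hasCompactSupport_bumpKernel d n) (Lp.stronglyMeasurable g) (Lp.stronglyMeasurable g)
    (Lp.memLp g) (Lp.memLp g)
  have h4 : (∫ x, (conj (mollify (bumpKernel d n) g x) * mollify (bumpKernel d n) g x).re)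
    = (∫ x, conj (mollify (bumpKernel d n) g x) * mollify (bumpKernel d n) g x).re := integral_re hi
  simp only [Function.comp_apply]
  rw [← h4]
  simp only [conj_mul_self_eq]

theorem integral_combination_im {f g : Space d → ℂ} (hf : Integrable f) (hg : Integrable g)
    (a b : ℝ) :
    ∫ x, (a * (f x).im + b * (g x).im) = a * (∫ x, f x).im + b * (∫ x, g x).im := by
  have h1 : ∫ x, (f x).im = (∫ x, f x).im := integral_im hf
  have h2 : ∫ x, (g x).im = (∫ x, g x).im := integral_im hg
  rw [← h1, ← h2, ← integral_const_mul, ← integral_const_mul]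
  exact integral_add (hf.im.const_mul a) (hg.im.const_mul b)

theorem integral_mollifiedRhs (hd : 1 ≤ d) {U : ℝ → L2 d} (μ : ℝ) (n : ℕ) {s : ℝ}
    (hs : s ∈ goodTimes U) :
    ∫ x, 2 * (conj (mollify (bumpKernel d n) (U s) x) *
      mollifiedRhs μ (bumpKernel d n) U s x).re = 2 * μ * (nonlinearPairing n U s).im := by
  have : ENNReal.HolderConjugate 2 2 := inferInstance
  have hφ := continuous_bumpKernel d n
  have hφs := contDiff_bumpKernel d n
  have hφc := hasCompactSupport_bumpKernel d n
  set φ := bumpKernel d n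
  have hlin := im_integral_mollify_mul hφ (continuous_laplacian hφs) hφc
    (hasCompactSupport_laplacian hφc) (bumpKernel_neg d n)
    (laplacian_neg_of_even hφs (bumpKernel_neg d n)) (Lp.stronglyMeasurable (U s)) (Lp.memLp (U s))
  have i1 := integrable_mollify_mul (p := 2) (p' := 2) hφ (continuous_laplacian hφs) hφc
    (hasCompactSupport_laplacian hφc) (Lp.stronglyMeasurable (U s)) (Lp.stronglyMeasurable (U s))
    (Lp.memLp (U s)) (Lp.memLp (U s))
  have i2 := integrable_mollify_mul_nonlinearity hd n hs
  have e (x : Space d) : 2 * (conj (mollify φ (U s) x) * mollifiedRhs μ φ U s x).re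
      = -2 * (conj (mollify φ (U s) x) * mollify (Δ φ) (U s) x).im
        + 2 * μ * (conj (mollify φ (U s) x) * mollifiedNonlinearity φ U s x).im := by
    rw [mollifiedRhs, show conj (mollify φ (U s) x) *
        (Complex.I * mollify (Δ φ) (U s) x - Complex.I * μ * mollifiedNonlinearity φ U s x)
      = Complex.I * (conj (mollify φ (U s) x) * mollify (Δ φ) (U s) x)
        - Complex.I * (μ * (conj (mollify φ (U s) x) * mollifiedNonlinearity φ U s x)) by ring,
      Complex.sub_re, Complex.I_mul_re, Complex.I_mul_re, Complex.im_ofReal_mul]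
    ring
  simp only [e]
  rw [integral_combination_im i1 i2, hlin, mul_zero, zero_add]
  rfl

/-- The identity for the squared modulus holds at each `x`; it is integrated over space, and Fubini
lets the kinetic term vanish at each good time. -/
theorem IsSolution.mollified_mass_identity (hd : 1 ≤ d) (h : IsSolution μ u T) (hb : b ∈ Ico 0 T)
    (n : ℕ) :
    (∫ x, ‖mollify (bumpKernel d n) (u b) x‖ ^ 2) - ∫ x, ‖mollify (bumpKernel d n) (u 0) x‖ ^ 2
      = ∫ s in Ioc 0 b, 2 * μ * (nonlinearPairing n (clampCurve u hb.1) s).im := by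
  have hφ := continuous_bumpKernel d n
  have hφs := contDiff_bumpKernel d n
  have hφc := hasCompactSupport_bumpKernel d n
  have hU := h.continuous_clampCurve hb
  set U := clampCurve u hb.1 with hU_def
  have hUb : U b = u b := clampCurve_eq u hb.1 (right_mem_Icc.2 hb.1)
  have hU0 : U 0 = u 0 := clampCurve_eq u hb.1 (left_mem_Icc.2 hb.1)
  rw [← hUb, ← hU0, ← integral_sub (integrable_norm_mollify_sq n _)
    (integrable_norm_mollify_sq n _)]
  set φ := bumpKernel d n
  have hpt (x : Space d) : ‖mollify φ (U b) x‖ ^ 2 - ‖mollify φ (U 0) x‖ ^ 2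
      = ∫ s in Ioc 0 b, 2 * (conj (mollify φ (U s) x) * mollifiedRhs μ φ U s x).re := by
    obtain ⟨hi, heq⟩ := h.mollify_eq_integral hd hb hφs hφc (bumpKernel_neg d n) x
    rw [← intervalIntegral.integral_of_le hb.1]
    exact norm_sq_sub_norm_sq_of_eq_integral (v := fun t => mollify φ (U t) x) hb.1 hi heq
  simp only [hpt]
  have hint : Integrable (Function.uncurry fun (x : Space d) (s : ℝ) =>
      2 * (conj (mollify φ (U s) x) * mollifiedRhs μ φ U s x).re)
      ((volume : Measure (Space d)).prod (volume.restrict (Ioc 0 b))) := by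
    have j1 := (integrable_linear_product hU hφ hφc (continuous_laplacian hφs)
      (hasCompactSupport_laplacian hφc) b).const_mul Complex.I
    have j2 := (h.integrable_nonlinear_product hd hb n).const_mul (Complex.I * μ)
    have j3 := ((j1.sub j2).re.const_mul 2).swap
    refine j3.congr (ae_of_all _ fun z => ?_)
    simp only [Function.comp_apply, Prod.fst_swap, Prod.snd_swap, Pi.sub_apply,
      RCLike.re_eq_complex_re, Function.uncurry, mollifiedRhs]
    congr 2
    ring
  rw [integral_integral_swap hint]
  refine integral_congr_ae ?_
  filter_upwards [h.ae_mem_goodTimes hd hb] with s hs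
  exact integral_mollifiedRhs hd μ n hs

theorem IsSolution.norm_eq (hd : 1 ≤ d) (h : IsSolution μ u T) (hb : b ∈ Ico 0 T) :
    ‖u b‖ = ‖u 0‖ := by
  have hU := h.continuous_clampCurve hb
  have hlim1 := (tendsto_integral_norm_mollify_sq (u b)).sub
    (tendsto_integral_norm_mollify_sq (u 0))
  have hlim2 : Tendsto (fun n => ∫ s in Ioc 0 b,
      2 * μ * (nonlinearPairing n (clampCurve u hb.1) s).im) atTop (𝓝 (∫ _ in Ioc 0 b, (0 : ℝ))) := by
    refine tendsto_integral_of_dominated_convergence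
      (fun s => |2 * μ| * (spacePow (clampCurve u hb.1 s)).toReal) (fun n => ?_) ?_ (fun n => ?_) ?_
    · exact ((h.integrable_nonlinear_product hd hb n).integral_prod_left.im.const_mul
        _).aestronglyMeasurable
    · exact (integrable_toReal_of_lintegral_ne_top
        (measurable_spacePow_curve hU).aemeasurable
        (h.lintegral_clampCurve_lt_top hd hb).ne).const_mul _
    · filter_upwards [h.ae_mem_goodTimes hd hb] with s hs
      rw [norm_mul, Real.norm_eq_abs, Real.norm_eq_abs]
      refine mul_le_mul_of_nonneg_left ((Complex.abs_im_le_norm _).trans ?_) (abs_nonneg _)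
      rw [← toReal_enorm]
      exact ENNReal.toReal_mono hs.ne (enorm_nonlinearPairing_le hd n s)
    · filter_upwards [h.ae_mem_goodTimes hd hb] with s hs
      simpa using (tendsto_nonlinearPairing hd hs).const_mul (2 * μ)
  simp only [h.mollified_mass_identity hd hb] at hlim1
  have h0 := tendsto_nhds_unique hlim1 hlim2
  rw [integral_zero, sub_eq_zero] at h0
  exact (pow_left_inj₀ (norm_nonneg _) (norm_nonneg _) two_ne_zero).1 h0

end Mass

/-! ### The pointwise lower bound -/

section Pointwise

variable {d : ℕ} {μ : ℝ} {u : ℝ → L2 d} {T η σ σ' ε α : ℝ} {t : ℕ → ℝ} {I : ℕ → Set ℝ}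

theorem PersistentConcentration.eventually_lt (hε : 0 < ε) (hσ' : σ' < 1)
    (h : PersistentConcentration u T α ε σ' I) :
    ∀ᶠ n in atTop, ∀ s ∈ I n, ENNReal.ofReal ((1 - σ') * ε / 2) < concentration u T α ε s := by
  have hpos : 0 < (1 - σ') * ε := mul_pos (sub_pos.2 hσ') hε
  -- Half of the assumed mass is given up: a strict inequality is needed to pass from the lower
  -- limit to all large `n`, and from the supremum to an actual cube.
  have h1 : ENNReal.ofReal ((1 - σ') * ε / 2) < ENNReal.ofReal ((1 - σ') * ε) :=
    (ENNReal.ofReal_lt_ofReal_iff hpos).2 (half_lt_self hpos)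
  filter_upwards [eventually_lt_of_lt_liminf (h1.trans_le h)] with n hn s hs
  exact hn.trans_le (iInf₂_le s hs)

theorem exists_eventually_spacePow_lower_bound (hd : 1 ≤ d) (hε : 0 < ε) (hσ' : σ' < 1) :
    ∃ c : ℝ, 0 < c ∧ ∀ (α μ : ℝ) (u : ℝ → L2 d) (T η σ : ℝ) (t : ℕ → ℝ) (I : ℕ → Set ℝ),
      IsSolution μ u T → IsStrichartzPartition u T η t → IsThickening σ t I →
      PersistentConcentration u T α ε σ' I →
      ∀ᶠ n in atTop, ∀ s ∈ I n, ENNReal.ofReal (c / (T - s) ^ (2 * α)) ≤ spacePow (u s) := by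
  have hpos : 0 < (1 - σ') * ε / 2 := half_pos (mul_pos (sub_pos.2 hσ') hε)
  obtain ⟨c, hc, hlow⟩ := exists_spacePow_lower_bound hd hε hpos
  refine ⟨c, hc, fun α μ u T η σ t I h hp hI hconc => ?_⟩
  filter_upwards [hconc.eventually_lt hε hσ'] with n hn s hs
  have hs' := hI.subset n hs
  have hsT : 0 < T - s := sub_pos.2 (hs'.2.trans (hp.lt _))
  have hmass := h.norm_eq hd ⟨(hp.nonneg n).trans hs'.1, hs'.2.trans (hp.lt _)⟩
  have hw := hn s hs
  simp only [concentration, lt_iSup_iff] at hw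
  obtain ⟨x₀, l, hl, hlt⟩ := hw
  have := hlow (u s) ‖u 0‖ ((T - s) ^ α) hmass.le (by positivity) ⟨x₀, l, hl.2, hlt.le⟩
  rwa [← Real.rpow_natCast ((T - s) ^ α), ← Real.rpow_mul hsT.le, Nat.cast_ofNat,
    mul_comm α] at this

end Pointwise

end CriticalNLS

end

/-! ### Assembly of the three conclusions. -/

open CriticalNLS in
theorem lemmaL (d : ℕ) (hd : 1 ≤ d) (ε σ σ' : ℝ) (hε : 0 < ε) (hσ : σ ∈ Ioo (0 : ℝ) 1)
    (hσ' : σ' ∈ Ioo (0 : ℝ) 1) :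
    ∃ c : ℝ, 0 < c ∧ ∃ η₀ : ℝ, 0 < η₀ ∧ ∀ α : ℝ, 1 / 2 ≤ α → ∃ c₁ : ℝ, 0 < c₁ ∧
      ∀ (μ : ℝ) (u : ℝ → L2 d) (T η : ℝ) (t : ℕ → ℝ) (I : ℕ → Set ℝ),
        μ = 1 ∨ μ = -1 → IsMaximalSolution μ u T → 0 < η → IsStrichartzPartition u T η t →
        IsThickening σ t I → PersistentConcentration u T α ε σ' I →
        -- the pointwise lower bound for the derivative
        (∀ᶠ n in atTop, ∀ᵐ s ∂(volume.restrict (I n)),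
          ∃ F' : ℝ, HasDerivAt (F u) F' s ∧ c / (T - s) ^ (2 * α) ≤ F') ∧
        -- its integrated form, window narrower than parabolic
        (1 / 2 < α → ∃ C : ℝ, ∀ n, ∀ s ∈ I n, c₁ * (1 / (T - s) ^ (2 * α - 1)) + C ≤ F u s) ∧
        -- its integrated form, parabolic window
        (α = 1 / 2 → (η ≤ η₀ ∨ ∀ᶠ n in atTop, (T - t n) / 2 ≤ T - t (n + 1)) →
          ∃ C : ℝ, ∀ n, ∀ s ∈ I n, c₁ * |Real.log (T - s)| + C ≤ F u s) := by
  obtain ⟨c, hc, hlow⟩ := exists_eventually_spacePow_lower_bound hd hε hσ'.2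
  have hq := strichartzExponent_pos hd
  have hσ0 := hσ.1
  set q := strichartzExponent d
  -- This `η₀` makes `η ^ q ≤ c * σ / 2`, so that for `α = 1/2` the step inequality itself yields
  -- the halving condition.
  refine ⟨c, hc, (c * σ / 2) ^ (1 / q), by positivity, fun α hα => ?_⟩
  -- The power constant divides by `2 * α - 1`, so the parabolic case needs its own value.
  refine ⟨if α = 1 / 2 then c * σ / 2 else
    c * σ / ((2 * α - 1) * 2 ^ (2 * α)) / 2 ^ (2 * α - 1), ?_, ?_⟩
  · split_ifs with h
    · positivity
    · have : 0 < 2 * α - 1 := by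
        have := lt_of_le_of_ne hα (Ne.symm h)
        linarith
      positivity
  intro μ u T η t I _ hmax hη hp hI hconc
  have h := hmax.toIsSolution
  have hbound := hlow α μ u T η σ t I h hp hI hconc
  have hstep : ∀ᶠ n in atTop, c * σ * ((T - t n) - (T - t (n + 1))) / (T - t n) ^ (2 * α)
      ≤ η ^ q := by
    filter_upwards [hbound] with n hn
    exact hp.step_le hd hη hI (by linarith) hc hn
  refine ⟨?_, fun hα' => ?_, fun hα' hη₀ => ?_⟩
  · filter_upwards [hbound] with n hn
    have hsub : I n ⊆ Icc 0 (t (n + 1)) := fun s hs =>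
      ⟨(hp.nonneg n).trans (hI.subset n hs).1, (hI.subset n hs).2.le⟩
    have hd1 := (h.ae_hasDerivAt_F hd (hp.mem (n + 1)))
    rw [restrict_Ioo_eq_restrict_Icc] at hd1
    filter_upwards [ae_restrict_of_ae_restrict_of_subset hsub hd1,
      ae_restrict_mem (hI.ordConnected n).measurableSet] with s hs hsI
    refine ⟨_, hs.2, ?_⟩
    have hsT : 0 < T - s := sub_pos.2 ((hI.subset n hsI).2.trans (hp.lt _))
    exact (ENNReal.ofReal_le_iff_le_toReal hs.1.ne).1 (hn s hsI)
  · rw [if_neg hα'.ne']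
    exact exists_power_lower_bound hd h hη hp hI hσ0 hc hα' hstep
  · rw [if_pos hα']
    subst hα'
    have hstep' : ∀ᶠ n in atTop, c * σ * ((T - t n) - (T - t (n + 1))) / (T - t n) ≤ η ^ q := by
      simpa using hstep
    refine exists_log_lower_bound hd h hη hp hI hσ0 hc hstep' ?_
    rcases hη₀ with hη₀ | hhalf
    · have hηq : η ^ q ≤ c * σ / 2 := by
        calc η ^ q ≤ ((c * σ / 2) ^ (1 / q)) ^ q := by gcongr
          _ = c * σ / 2 := by
            rw [← Real.rpow_mul (by positivity), one_div_mul_cancel hq.ne', Real.rpow_one]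
      filter_upwards [hstep'] with n hn
      have hx : 0 < T - t n := sub_pos.2 (hp.lt n)
      have h1 := hn.trans hηq
      rw [div_le_iff₀ hx] at h1
      have h2 : 0 < c * σ := by positivity
      nlinarith
    · exact hhalf
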